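/- Let $\mathcal S,\mathcal A$ be finite sets with $|\mathcal S|,|\mathcal A|>1$, $\gamma\in(0,1)$, $\nu_0\in\Delta_{\mathcal S}$ an initial distribution, and write $H_\gamma=1/(1-\gamma)$. For a transition law $P\in\Delta_{\mathcal S}^{\mathcal S\times\mathcal A}$ let $$\mathcal M_P=\Big\{\mu\in\mathbb R_{\ge0}^{\mathcal S\times\mathcal A}:\ \sum_a\mu(s,a)-\gamma\sum_{s',a'}P(s|s',a')\mu(s',a')=(1-\gamma)\nu_0(s)\ \ \forall s\Big\}$$ be the set of occupancy measures and $\mathcal U_P=\{(s,a)\mapsto v(s)-\gamma\sum_{s'}P(s'|s,a)v(s') : v\in\mathbb R^{\mathcal S}\}\subseteq\mathbb R^{\mathcal S\times\mathcal A}$. Let $\theta_2(P,P')$ be the second principal angle between $\mathcal U_P$ and $\mathcal U_{P'}$: $\cos\theta_2=\max\langle v,w\rangle$ over unit vectors $v\in\mathcal U_P$, $w\in\mathcal U_{P'}$ with $\langle v,v_1\rangle=\langle w,w_1\rangle=0$, where $(v_1,w_1)$ maximizes $\langle v,w\rangle$ over unit vectors $v\in\mathcal U_P$, $w\in\mathcal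 U_{P'}$, and $\theta_2\in[0,\pi/2]$. For a regularizer $h:\Delta_{\mathcal A}\to\mathbb R$ put $J(r,\mu)=\langle r,\mu\rangle-\sum_{s,a}\mu(s,a)h(\pi^\mu(\cdot|s))$ with $\pi^\mu(a|s)=\mu(s,a)/\sum_{a'}\mu(s,a')$ (uniform if the denominator is $0$), let $\mathsf{RL}_P(r)$ be the maximizer of $J(r,\cdot)$ over $\mathcal M_P$, and $\mathsf{SubOpt}_P(r,\mu)=\max_{\mu'\in\mathcal M_P}J(r,\mu')-J(r,\mu)$. Let $\mathcal R\subset\mathbb R^{\mathcal S\times\mathcal A}$ be compact, $r^{\mathsf E},\hat r\in\mathcal R$, $R=\max_{r\in\mathcal R}\|r\|_\infty$, $D=\max_{r,r'\in\mathcal R}\|r-r'\|_2$, and $0<\tau<D$. Let $P^0,P^1$ be transition laws with $\theta_2(P^0,P^1)>0$, and let $\nu_{\min}>0$ be such that $\sum_a\mu(s,a)\ge\nu_{\min}$ for all $s\in\mathcal S$ and all $\mu\in\mathcal M_{P^0}\cup\mathcal M_{P^1}$. Let $h$ be one of the two regularizers below, and suppose that the experts $\mu^{\mathsf E}_{P^k}=\mathsf{RL}_{P^k}(r^{\mathsf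 E})$ satisfy $\mathsf{SubOpt}_{P^k}(\hat r,\mu^{\mathsf E}_{P^k})\le\hat\varepsilon$ for $k=0,1$. Then $\hat r$ is $\varepsilon$-transferable to all transition laws, that is, $\mathsf{SubOpt}_P(r^{\mathsf E},\mathsf{RL}_P(\hat r))\le\varepsilon$ for every $P\in\Delta_{\mathcal S}^{\mathcal S\times\mathcal A}$, with the following $\varepsilon$. (a) For the Shannon entropy, $h(p)=\tau\sum_a p(a)\log p(a)$: $$\varepsilon=\frac{2H_\gamma^2D|\mathcal S||\mathcal A|^{2+H_\gamma}\exp(2RH_\gamma/\tau)}{\nu_{\min}^2\,\tau\,\sin^2(\theta_2(P^0,P^1)/2)}\,\hat\varepsilon.$$ (b) For the Tsallis-$1/2$ entropy, $h(p)=-2\tau\big(\sum_a\sqrt{p(a)}-1\big)$: $$\varepsilon=\frac{4\sqrt2\,H_\gamma^5D|\mathcal S||\mathcal A|^2\big(2R/\tau+3\sqrt{|\mathcal A|}\big)^3}{\nu_{\min}^2\,\tau\,\sin^2(\theta_2(P^0,P^1)/2)}\,\hat\varepsilon.$$ -/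

import Mathlib

noncomputable section

/-! ### Principal angles between subspaces -/

/-- `p = (v, w)` is a pair of unit vectors `v ∈ V`, `w ∈ W` that maximises the inner product among
all such pairs. -/
def IsPrincipalPair {E : Type*} [NormedAddCommGroup E] [InnerProductSpace ℝ E]
    (V W : Submodule ℝ E) (p : E × E) : Prop :=
  p.1 ∈ V ∧ p.2 ∈ W ∧ ‖p.1‖ = 1 ∧ ‖p.2‖ = 1 ∧
    ∀ v ∈ V, ∀ w ∈ W, ‖v‖ = 1 → ‖w‖ = 1 → inner ℝ v w ≤ inner ℝ p.1 p.2

/-- Maximising pairs exist between nonzero subspaces of a finite-dimensional space. -/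
theorem exists_isPrincipalPair {E : Type*} [NormedAddCommGroup E] [InnerProductSpace ℝ E]
    [FiniteDimensional ℝ E] {V W : Submodule ℝ E} (hV : V ≠ ⊥) (hW : W ≠ ⊥) :
    ∃ p : E × E, IsPrincipalPair V W p := by
  have key : ∀ U : Submodule ℝ E, U ≠ ⊥ →
      IsCompact ((U : Set E) ∩ Metric.sphere 0 1) ∧ ((U : Set E) ∩ Metric.sphere 0 1).Nonempty := by
    intro U hU
    refine ⟨(isCompact_sphere (0 : E) 1).inter_left U.closed_of_finiteDimensional, ?_⟩
    obtain ⟨x, hx, hx0⟩ := U.exists_mem_ne_zero_of_ne_bot hU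
    refine ⟨(‖x‖⁻¹ : ℝ) • x, U.smul_mem _ hx, ?_⟩
    have : ‖x‖ ≠ 0 := norm_ne_zero_iff.mpr hx0
    simp [norm_smul, this]
  obtain ⟨p, hp, hmax⟩ := ((key V hV).1.prod (key W hW).1).exists_isMaxOn
    ((key V hV).2.prod (key W hW).2)
    (f := fun p : E × E => inner ℝ p.1 p.2) (continuous_fst.inner continuous_snd).continuousOn
  refine ⟨p, hp.1.1, hp.2.1, by simpa using hp.1.2, by simpa using hp.2.2, ?_⟩
  intro v hv w hw hv1 hw1
  exact hmax (show (v, w) ∈ _ from ⟨⟨hv, by simpa using hv1⟩, ⟨hw, by simpa using hw1⟩⟩)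

open Classical in
/-- A chosen pair of first principal vectors of `V` and `W`. -/
def principalPair {E : Type*} [NormedAddCommGroup E] [InnerProductSpace ℝ E]
    (V W : Submodule ℝ E) : E × E :=
  if h : ∃ p : E × E, IsPrincipalPair V W p then h.choose else 0

/-- The `i`-th principal angle `θ_i(V, W)`, `i = 1, …, m`, of two subspaces of dimension `m`:
`cos θ_i` is the maximum of `⟪v, w⟫` over unit vectors `v ∈ V`, `w ∈ W` that are orthogonal to the
previously chosen maximisers `v_1, …, v_{i-1}` and `w_1, …, w_{i-1}`, respectively. The recursion
passes to the orthogonal complements of the first maximisers inside `V` and `W`. The index starts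
at `1`; the value at `0` is a dummy. -/
def principalAngle {E : Type*} [NormedAddCommGroup E] [InnerProductSpace ℝ E] :
    ℕ → Submodule ℝ E → Submodule ℝ E → ℝ
  | 0, _, _ => 0
  | 1, V, W => Real.arccos (inner ℝ (principalPair V W).1 (principalPair V W).2)
  | i + 2, V, W => principalAngle (i + 1)
      (V ⊓ (Submodule.span ℝ {(principalPair V W).1})ᗮ)
      (W ⊓ (Submodule.span ℝ {(principalPair V W).2})ᗮ)

/-! ### Regularized Markov decision processes -/

/-- Transition laws: `P s a` is the distribution of the next state, `P(s' | s, a) = (P s a).1 s'`. -/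
abbrev TransitionLaw (S A : Type*) [Fintype S] : Type _ := S → A → stdSimplex ℝ S

/-- The operator `(E v)(s, a) = v(s)`. -/
def liftOp (S A : Type*) : (S → ℝ) →ₗ[ℝ] EuclideanSpace ℝ (S × A) where
  toFun v := WithLp.toLp 2 fun x => v x.1
  map_add' _ _ := rfl
  map_smul' _ _ := rfl

/-- The operator `(P v)(s, a) = ∑ s', P(s' | s, a) v(s')`. -/
def transOp {S A : Type*} [Fintype S] (P : TransitionLaw S A) :
    (S → ℝ) →ₗ[ℝ] EuclideanSpace ℝ (S × A) where
  toFun v := WithLp.toLp 2 fun x => ∑ s', (P x.1 x.2).1 s' * v s'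
  map_add' v w := by
    ext x
    simp [mul_add, Finset.sum_add_distrib]
  map_smul' c v := by
    ext x
    simp [Finset.mul_sum, mul_left_comm]

/-- The subspace `U_P = im (E - γ P)` of potential shaping transformations. -/
def shapingSpace {S A : Type*} [Fintype S] (γ : ℝ) (P : TransitionLaw S A) :
    Submodule ℝ (EuclideanSpace ℝ (S × A)) :=
  LinearMap.range (liftOp S A - γ • transOp P)

/-- The `i`-th principal angle `θ_i(P, P') = θ_i(U_P, U_{P'})` between two transition laws. -/
def lawAngle {S A : Type*} [Fintype S] [Fintype A] (γ : ℝ) (i : ℕ) (P P' : TransitionLaw S A) : ℝ :=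
  principalAngle i (shapingSpace γ P) (shapingSpace γ P')

/-- The state marginal `ν(s) = ∑ a, μ(s, a)`. -/
def stateMarginal {S A : Type*} [Fintype A] (μ : EuclideanSpace ℝ (S × A)) (s : S) : ℝ :=
  ∑ a, μ (s, a)

/-- The set of occupancy measures: `μ ≥ 0` and the Bellman flow constraints
`(E - γ P)ᵀ μ = (1 - γ) ν₀`. -/
def occupancySet {S A : Type*} [Fintype S] [Fintype A] (γ : ℝ) (ν₀ : S → ℝ)
    (P : TransitionLaw S A) : Set (EuclideanSpace ℝ (S × A)) :=
  {μ | (∀ x, 0 ≤ μ x) ∧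
    ∀ s, stateMarginal μ s - γ * ∑ s', ∑ a', (P s' a').1 s * μ (s', a') = (1 - γ) * ν₀ s}

open Classical in
/-- The policy `π^μ(· | s)` of `μ` (uniform, which is arbitrary, where `ν(s) = 0`). -/
def policyOf {S A : Type*} [Fintype A] (μ : EuclideanSpace ℝ (S × A)) (s : S) : A → ℝ :=
  fun a => if 0 < stateMarginal μ s then μ (s, a) / stateMarginal μ s
    else 1 / (Fintype.card A : ℝ)

/-- The regularization of occupancy measures
`hbar(μ) = 𝔼_{(s, a) ∼ μ} [h(π^μ(· | s))]`. -/
def occReg {S A : Type*} [Fintype S] [Fintype A] (h : (A → ℝ) → ℝ)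
    (μ : EuclideanSpace ℝ (S × A)) : ℝ :=
  ∑ s, ∑ a, μ (s, a) * h (policyOf μ s)

/-- The regularized objective `J(r, μ) = ⟨r, μ⟩ - hbar(μ)`. -/
def objective {S A : Type*} [Fintype S] [Fintype A] (h : (A → ℝ) → ℝ)
    (r μ : EuclideanSpace ℝ (S × A)) : ℝ :=
  inner ℝ r μ - occReg h μ

/-- `RL_P(r)`: the set of maximisers of `J(r, ·)` over the occupancy measures. -/
def optimalSet {S A : Type*} [Fintype S] [Fintype A] (γ : ℝ) (ν₀ : S → ℝ) (h : (A → ℝ) → ℝ)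
    (P : TransitionLaw S A) (r : EuclideanSpace ℝ (S × A)) : Set (EuclideanSpace ℝ (S × A)) :=
  {μ | μ ∈ occupancySet γ ν₀ P ∧ ∀ μ' ∈ occupancySet γ ν₀ P, objective h r μ' ≤ objective h r μ}

/-- `SubOpt_P(r, μ) = max_{μ'} J(r, μ') - J(r, μ)`. -/
def subOpt {S A : Type*} [Fintype S] [Fintype A] (γ : ℝ) (ν₀ : S → ℝ) (h : (A → ℝ) → ℝ)
    (P : TransitionLaw S A) (r μ : EuclideanSpace ℝ (S × A)) : ℝ :=
  sSup (objective h r '' occupancySet γ ν₀ P) - objective h r μ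

/-- `rhat` is `ε`-transferable to the set `Ps` of transition laws (for the true reward `rE`): for
each `P ∈ Ps`, an optimal occupancy measure for `rhat` exists, and it is `ε`-optimal for `rE`. -/
def IsTransferable {S A : Type*} [Fintype S] [Fintype A] (γ : ℝ) (ν₀ : S → ℝ) (h : (A → ℝ) → ℝ)
    (rE rhat : EuclideanSpace ℝ (S × A)) (Ps : Set (TransitionLaw S A)) (ε : ℝ) : Prop :=
  ∀ P ∈ Ps, (optimalSet γ ν₀ h P rhat).Nonempty ∧
    ∀ μ ∈ optimalSet γ ν₀ h P rhat, subOpt γ ν₀ h P rE μ ≤ ε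

/-- The Shannon entropy `-∑ a, p(a) log p(a)`. -/
def shannonEntropy {A : Type*} [Fintype A] (p : A → ℝ) : ℝ := ∑ a, Real.negMulLog (p a)

/-- The Tsallis entropy `(1 - ∑ a, p(a) ^ α) / (α - 1)`. -/
def tsallisEntropy {A : Type*} [Fintype A] (α : ℝ) (p : A → ℝ) : ℝ :=
  1 / (α - 1) * (1 - ∑ a, p a ^ α)

/-- The Shannon regularizer with parameter `τ`. -/
def shannonReg {A : Type*} [Fintype A] (τ : ℝ) (p : A → ℝ) : ℝ := -τ * shannonEntropy p

/-- The Tsallis-1/2 regularizer with parameter `τ`. -/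
def tsallisReg {A : Type*} [Fintype A] (τ : ℝ) (p : A → ℝ) : ℝ := -τ * tsallisEntropy (1 / 2) p

/-- The effective horizon `H_γ = 1 / (1 - γ)`. -/
def effHorizon (γ : ℝ) : ℝ := 1 / (1 - γ)

/-- `R = max_{r ∈ 𝓡} ‖r‖_∞` (the norm of functions on a finite type is the maximum norm). -/
def rewardBound {S A : Type*} [Fintype S] [Fintype A]
    (𝓡 : Set (EuclideanSpace ℝ (S × A))) : ℝ :=
  sSup ((fun r => ‖(WithLp.ofLp r : S × A → ℝ)‖) '' 𝓡)

/-- `D = max_{r, r' ∈ 𝓡} ‖r - r'‖₂`. -/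
def rewardDiam {S A : Type*} [Fintype S] [Fintype A]
    (𝓡 : Set (EuclideanSpace ℝ (S × A))) : ℝ :=
  Metric.diam 𝓡

end

/-! ### Angles between subspaces with a common line -/

/-! Near-optimality of the expert under P^k confines r̂ - r^E to a neighbourhood of U_{P^k}. Let d
be the component of r̂ - r^E orthogonal to U_{P^k}. Moving the expert along d preserves the flow
constraints; it gains t‖d‖² in the linear term and loses only O(t²‖d‖²) in J(r^E, ·). As the total
gain is at most ε̂, ‖d‖² is O(ε̂) (`norm_sub_starProjection_sq_le`).

Every shaping space contains the constants. If the second angle is positive they are the whole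
intersection, and a vector near both spaces is near the constant line, with loss factor 1/sin²(θ₂/2)
in squared distance (`exists_norm_sub_smul_sq_mul_sin_sq_le`). A constant shift of the reward
changes no optimum, and J grows quadratically in ℓ¹ away from its maximizer, so closeness up to
constants bounds the suboptimality under every law (`subOpt_le_of_norm_sub_smul`).

The growth and smoothness estimates are statewise. By `IsBellmanSolution.objective_eq`, the deficit
of an occupancy measure is the sum over states of its marginal times the gap of a regularized
problem over the simplex. Hence a regularizer enters only through `IsSoftmax` (quadratic growth) and
`IsSmoothAt` (a quadratic upper bound, with c / p ≤ κ). These hold for Shannon entropy because its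
gap is a relative entropy, and for Tsallis-1/2 because its gap is a weighted Hellinger distance. -/

theorem principalPair_spec {E : Type*} [NormedAddCommGroup E] [InnerProductSpace ℝ E]
    [FiniteDimensional ℝ E] {V W : Submodule ℝ E} (hV : V ≠ ⊥) (hW : W ≠ ⊥) :
    IsPrincipalPair V W (principalPair V W) := by
  have h := exists_isPrincipalPair hV hW
  rw [principalPair, dif_pos h]
  exact h.choose_spec

theorem principalAngle_two {E : Type*} [NormedAddCommGroup E] [InnerProductSpace ℝ E]
    (V W : Submodule ℝ E) : principalAngle 2 V W = principalAngle 1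
      (V ⊓ (Submodule.span ℝ {(principalPair V W).1})ᗮ)
      (W ⊓ (Submodule.span ℝ {(principalPair V W).2})ᗮ) := rfl

/-- If `V` and `W` share a unit vector, their first principal vectors coincide. -/
theorem principalPair_eq_of_common_unit {E : Type*} [NormedAddCommGroup E] [InnerProductSpace ℝ E]
    {V W : Submodule ℝ E} {p : E × E} (hp : IsPrincipalPair V W p) {e : E}
    (heV : e ∈ V) (heW : e ∈ W) (he : e ≠ 0) : p.1 = p.2 := by
  obtain ⟨-, -, h1, h2, hmax⟩ := hp
  have hu : ‖(‖e‖⁻¹ : ℝ) • e‖ = 1 := by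
    have : ‖e‖ ≠ 0 := norm_ne_zero_iff.mpr he
    simp [norm_smul, this]
  have h := hmax _ (V.smul_mem (‖e‖⁻¹ : ℝ) heV) _ (W.smul_mem (‖e‖⁻¹ : ℝ) heW) hu hu
  rw [real_inner_self_eq_norm_sq, hu] at h
  have h3 : inner ℝ p.1 p.2 = 1 :=
    le_antisymm (by simpa [h1, h2] using real_inner_le_norm p.1 p.2) (by simpa using h)
  exact (inner_eq_one_iff_of_norm_eq_one h1 h2).mp h3

/-- If the second principal angle of two subspaces containing `e ≠ 0` is positive, then vectors
orthogonal to `e` make at least that angle. -/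
theorem inner_le_cos_principalAngle_two {E : Type*} [NormedAddCommGroup E] [InnerProductSpace ℝ E]
    [FiniteDimensional ℝ E] {V W : Submodule ℝ E} {e : E} (heV : e ∈ V) (heW : e ∈ W) (he : e ≠ 0)
    (hθ : 0 < principalAngle 2 V W) {v w : E} (hv : v ∈ V) (hw : w ∈ W) (hv1 : ‖v‖ = 1)
    (hw1 : ‖w‖ = 1) (hve : inner ℝ e v = 0) (hwe : inner ℝ e w = 0) :
    inner ℝ v w ≤ Real.cos (principalAngle 2 V W) := by
  have hV : V ≠ ⊥ := fun h => he (by simpa [h] using heV)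
  have hW : W ≠ ⊥ := fun h => he (by simpa [h] using heW)
  have hp := principalPair_spec hV hW
  have heq := principalPair_eq_of_common_unit hp heV heW he
  set x := (principalPair V W).1 with hx
  have hang : principalAngle 2 V W = principalAngle 1 (V ⊓ (Submodule.span ℝ {x})ᗮ)
      (W ⊓ (Submodule.span ℝ {x})ᗮ) := by
    rw [principalAngle_two, ← heq]
  set V' := V ⊓ (Submodule.span ℝ {x})ᗮ
  set W' := W ⊓ (Submodule.span ℝ {x})ᗮ
  have hx1 : ‖x‖ = 1 := hp.2.2.1
  -- Otherwise the part of e orthogonal to x would be a nonzero vector common to `V'` and `W'`, and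
  -- the second angle would be zero.
  have hxe : e = (inner ℝ x e : ℝ) • x := by
    by_contra hne
    have hy0 : e - (inner ℝ x e : ℝ) • x ≠ 0 := sub_ne_zero.mpr hne
    have hyx : e - (inner ℝ x e : ℝ) • x ∈ (Submodule.span ℝ {x})ᗮ := by
      rw [Submodule.mem_orthogonal_singleton_iff_inner_right, inner_sub_right, inner_smul_right,
        real_inner_self_eq_norm_sq, hx1]
      ring
    have hyV : e - (inner ℝ x e : ℝ) • x ∈ V' :=
      ⟨V.sub_mem heV (V.smul_mem _ hp.1), hyx⟩
    have hyW : e - (inner ℝ x e : ℝ) • x ∈ W' :=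
      ⟨W.sub_mem heW (W.smul_mem _ (heq ▸ hp.2.1)), hyx⟩
    have hq := principalPair_spec (V := V') (W := W')
      (fun h => hy0 (by simpa [h] using hyV)) (fun h => hy0 (by simpa [h] using hyW))
    have hqe := principalPair_eq_of_common_unit hq hyV hyW hy0
    rw [hang, principalAngle, ← hqe, real_inner_self_eq_norm_sq, hq.2.2.1] at hθ
    simp at hθ
  have hc : (inner ℝ x e : ℝ) ≠ 0 := by
    intro h
    rw [h, zero_smul] at hxe
    exact he hxe
  have key : ∀ u : E, inner ℝ e u = 0 → u ∈ (Submodule.span ℝ {x})ᗮ := by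
    intro u hu
    rw [Submodule.mem_orthogonal_singleton_iff_inner_right]
    rw [hxe, real_inner_smul_left] at hu
    exact (mul_eq_zero.mp hu).resolve_left hc
  have hvV : v ∈ V' := ⟨hv, key v hve⟩
  have hwW : w ∈ W' := ⟨hw, key w hwe⟩
  have hq := principalPair_spec (V := V') (W := W')
    (fun h => by rw [h, Submodule.mem_bot] at hvV; simp [hvV] at hv1)
    (fun h => by rw [h, Submodule.mem_bot] at hwW; simp [hwW] at hw1)
  rw [hang, principalAngle, Real.cos_arccos]
  · exact hq.2.2.2.2 v hvV w hwW hv1 hw1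
  · have := abs_real_inner_le_norm (principalPair V' W').1 (principalPair V' W').2
    rw [hq.2.2.1, hq.2.2.2.1, mul_one] at this
    exact (abs_le.mp this).1
  · have := abs_real_inner_le_norm (principalPair V' W').1 (principalPair V' W').2
    rw [hq.2.2.1, hq.2.2.2.1, mul_one] at this
    exact (abs_le.mp this).2

theorem principalAngle_two_mem_Icc {E : Type*} [NormedAddCommGroup E] [InnerProductSpace ℝ E]
    (V W : Submodule ℝ E) : principalAngle 2 V W ∈ Set.Icc 0 Real.pi := by
  rw [principalAngle, principalAngle]
  exact ⟨Real.arccos_nonneg _, Real.arccos_le_pi _⟩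

/-- A vector close to both `V` and `W` is close to their common line. -/
theorem exists_norm_sub_smul_sq_mul_sin_sq_le {E : Type*} [NormedAddCommGroup E]
    [InnerProductSpace ℝ E] [FiniteDimensional ℝ E] {V W : Submodule ℝ E} {e : E} (heV : e ∈ V)
    (heW : e ∈ W) (he : e ≠ 0) (hθ : 0 < principalAngle 2 V W) {x : E} {B : ℝ}
    (hxV : ‖x - V.starProjection x‖ ^ 2 ≤ B) (hxW : ‖x - W.starProjection x‖ ^ 2 ≤ B) :
    ∃ c : ℝ, ‖x - c • e‖ ^ 2 * Real.sin (principalAngle 2 V W / 2) ^ 2 ≤ B := by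
  have he2 : ‖e‖ ^ 2 ≠ 0 := by simpa using he
  refine ⟨inner ℝ e x / ‖e‖ ^ 2, ?_⟩
  set c := inner ℝ e x / ‖e‖ ^ 2 with hc
  set y := x - c • e with hy
  set θ := principalAngle 2 V W with hθdef
  have hye : inner ℝ e y = 0 := by
    rw [hy, inner_sub_right, inner_smul_right, real_inner_self_eq_norm_sq, hc]
    field_simp
    ring
  have hcos : 0 ≤ Real.cos (θ / 2) := by
    obtain ⟨h0, h1⟩ := principalAngle_two_mem_Icc V W
    exact Real.cos_nonneg_of_mem_Icc ⟨by linarith [Real.pi_pos], by linarith⟩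
  -- Subtracting a multiple of e does not change the residual, since projections onto subspaces
  -- containing e fix it.
  have hsub : ∀ U : Submodule ℝ E, e ∈ U → y - U.starProjection y = x - U.starProjection x := by
    intro U hU
    have : U.starProjection e = e := Submodule.starProjection_eq_self_iff.mpr hU
    rw [hy, map_sub, map_smul, this]
    abel
  have hortho : ∀ U : Submodule ℝ E, ∀ u ∈ U, inner ℝ u y = inner ℝ u (U.starProjection y) := by
    intro U u hu
    have h := U.sub_starProjection_mem_orthogonal y
    have h2 := (Submodule.mem_orthogonal U _).mp h u hu
    rw [inner_sub_right] at h2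
    linarith
  have hpyth : ∀ U : Submodule ℝ E, e ∈ U →
      ‖y‖ ^ 2 = ‖U.starProjection y‖ ^ 2 + ‖x - U.starProjection x‖ ^ 2 := by
    intro U hU
    have h0 := hortho U _ (U.starProjection_apply_mem y)
    rw [real_inner_self_eq_norm_sq, real_inner_comm] at h0
    rw [← hsub U hU, norm_sub_sq_real y, h0]
    ring
  -- The normalized projections v, w of y are orthogonal to e, so they make an angle of at least θ
  -- and ‖v + w‖ ≤ 2 cos(θ/2). Pairing v + w with y bounds the sum of the two projection norms by 2
  -- cos(θ/2) ‖y‖, so one of them is at most half of this. The zero cases are separate because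
  -- normalization fails there.
  have hmin : ‖V.starProjection y‖ ≤ ‖y‖ * Real.cos (θ / 2) ∨
      ‖W.starProjection y‖ ≤ ‖y‖ * Real.cos (θ / 2) := by
    by_cases hv0 : V.starProjection y = 0
    · left
      rw [hv0, norm_zero]
      positivity
    by_cases hw0 : W.starProjection y = 0
    · right
      rw [hw0, norm_zero]
      positivity
    have hunit : ∀ u : E, u ≠ 0 → ‖(‖u‖⁻¹ : ℝ) • u‖ = 1 := by
      intro u hu
      have : ‖u‖ ≠ 0 := norm_ne_zero_iff.mpr hu
      simp [norm_smul, this]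
    have hin : ∀ U : Submodule ℝ E, U.starProjection y ≠ 0 →
        inner ℝ ((‖U.starProjection y‖⁻¹ : ℝ) • U.starProjection y) y = ‖U.starProjection y‖ := by
      intro U hU
      have : ‖U.starProjection y‖ ≠ 0 := norm_ne_zero_iff.mpr hU
      rw [real_inner_smul_left, hortho U _ (U.starProjection_apply_mem y),
        real_inner_self_eq_norm_sq]
      field_simp
    have hin0 : ∀ U : Submodule ℝ E, e ∈ U →
        inner ℝ e ((‖U.starProjection y‖⁻¹ : ℝ) • U.starProjection y) = 0 := by
      intro U hU
      rw [inner_smul_right, ← hortho U e hU, hye, mul_zero]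
    set v := (‖V.starProjection y‖⁻¹ : ℝ) • V.starProjection y with hv
    set w := (‖W.starProjection y‖⁻¹ : ℝ) • W.starProjection y with hw
    have hvw : inner ℝ v w ≤ Real.cos θ :=
      inner_le_cos_principalAngle_two heV heW he hθ
        (V.smul_mem _ (V.starProjection_apply_mem y)) (W.smul_mem _ (W.starProjection_apply_mem y))
        (hunit _ hv0) (hunit _ hw0) (hin0 V heV) (hin0 W heW)
    have hnorm : ‖v + w‖ ≤ 2 * Real.cos (θ / 2) := by
      refine abs_le_of_sq_le_sq' ?_ (by positivity) |>.2
      rw [norm_add_sq_real, hunit _ hv0, hunit _ hw0]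
      have : Real.cos θ = 2 * Real.cos (θ / 2) ^ 2 - 1 := by
        rw [← Real.cos_two_mul]
        congr 1
        ring
      nlinarith
    have hcs := real_inner_le_norm (v + w) y
    rw [inner_add_left, hin V hv0, hin W hw0] at hcs
    by_contra! hcon
    nlinarith [norm_nonneg y]
  have hsin := Real.sin_sq (θ / 2)
  rw [hsin]
  have : ∀ U : Submodule ℝ E, e ∈ U → ‖x - U.starProjection x‖ ^ 2 ≤ B →
      ‖U.starProjection y‖ ≤ ‖y‖ * Real.cos (θ / 2) →
      ‖y‖ ^ 2 * (1 - Real.cos (θ / 2) ^ 2) ≤ B := by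
    intro U hU hB h
    have h1 := hpyth U hU
    have h2 : ‖U.starProjection y‖ ^ 2 ≤ (‖y‖ * Real.cos (θ / 2)) ^ 2 := by gcongr
    nlinarith
  rcases hmin with h | h
  · exact this V heV hxV h
  · exact this W heW hxW h

noncomputable section

/-! ### Regularized maximization over the simplex -/

/-- The loss of `p'` against `p` in the regularized problem `max_p ⟨p, q⟩ - h p`. -/
def regGap {A : Type*} [Fintype A] (h : (A → ℝ) → ℝ) (q p p' : A → ℝ) : ℝ :=
  (∑ a, p a * q a - h p) - (∑ a, p' a * q a - h p')

/-- `p` maximizes `⟨p, q⟩ - h p` over the simplex, with quadratic growth in the `ℓ¹` norm. -/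
def IsSoftmax {A : Type*} [Fintype A] (h : (A → ℝ) → ℝ) (τ : ℝ) (q p : A → ℝ) : Prop :=
  p ∈ stdSimplex ℝ A ∧
    ∀ p' ∈ stdSimplex ℝ A, τ / 4 * (∑ a, |p' a - p a|) ^ 2 ≤ regGap h q p p'

/-- `p` is bounded below by `κ⁻¹`, and the loss against `p` is at most quadratic. -/
def IsSmoothAt {A : Type*} [Fintype A] (h : (A → ℝ) → ℝ) (τ κ : ℝ) (q p : A → ℝ) : Prop :=
  (∀ a, 0 < p a ∧ 1 ≤ κ * p a) ∧ ∃ c : ℝ, 0 ≤ c ∧ (∀ a, c ≤ κ * p a) ∧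
    ∀ p' ∈ stdSimplex ℝ A, regGap h q p p' ≤ τ * c * ∑ a, (p' a - p a) ^ 2 / p a

/-- The squared `ℓ¹` distance is at most four times a weighted Hellinger distance. -/
theorem sum_abs_sub_sq_le {A : Type*} [Fintype A] {p p' w : A → ℝ} (hp : p ∈ stdSimplex ℝ A)
    (hp' : p' ∈ stdSimplex ℝ A) (hw : ∀ a, 0 < w a) (hw1 : ∀ a, w a ≤ 1) :
    (∑ a, |p' a - p a|) ^ 2 ≤ 4 * ∑ a, (√(p' a) - √(p a)) ^ 2 / w a := by
  -- This difference-of-squares factorization, split by √w, prepares Cauchy–Schwarz; the second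
  -- factor has square sum at most 4 because w ≤ 1.
  have h1 : ∀ a, |p' a - p a| =
      (|√(p' a) - √(p a)| / √(w a)) * (√(w a) * (√(p' a) + √(p a))) := by
    intro a
    have : √(w a) ≠ 0 := (Real.sqrt_pos.mpr (hw a)).ne'
    have h2 : p' a - p a = (√(p' a) - √(p a)) * (√(p' a) + √(p a)) := by
      nlinarith [Real.sq_sqrt (hp.1 a), Real.sq_sqrt (hp'.1 a)]
    rw [h2, abs_mul, abs_of_nonneg (by positivity : 0 ≤ √(p' a) + √(p a))]
    field_simp
  have h2 : ∑ a, (√(w a) * (√(p' a) + √(p a))) ^ 2 ≤ 4 := by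
    calc ∑ a, (√(w a) * (√(p' a) + √(p a))) ^ 2 ≤ ∑ a, (2 * p' a + 2 * p a) := by
          refine Finset.sum_le_sum fun a _ => ?_
          rw [mul_pow, Real.sq_sqrt (hw a).le]
          have : (√(p' a) + √(p a)) ^ 2 ≤ 2 * p' a + 2 * p a := by
            nlinarith [Real.sq_sqrt (hp.1 a), Real.sq_sqrt (hp'.1 a),
              sq_nonneg (√(p' a) - √(p a))]
          nlinarith [hw a, hw1 a, sq_nonneg (√(p' a) + √(p a))]
      _ = 4 := by
          rw [Finset.sum_add_distrib, ← Finset.mul_sum, ← Finset.mul_sum, hp.2, hp'.2]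
          norm_num
  have h3 : ∀ a, (|√(p' a) - √(p a)| / √(w a)) ^ 2 = (√(p' a) - √(p a)) ^ 2 / w a := by
    intro a
    rw [div_pow, sq_abs, Real.sq_sqrt (hw a).le]
  calc (∑ a, |p' a - p a|) ^ 2
      = (∑ a, (|√(p' a) - √(p a)| / √(w a)) * (√(w a) * (√(p' a) + √(p a)))) ^ 2 := by
        simp_rw [h1]
    _ ≤ (∑ a, (|√(p' a) - √(p a)| / √(w a)) ^ 2) *
        ∑ a, (√(w a) * (√(p' a) + √(p a))) ^ 2 := Finset.sum_mul_sq_le_sq_mul_sq _ _ _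
    _ ≤ (∑ a, (√(p' a) - √(p a)) ^ 2 / w a) * 4 := by
        simp_rw [h3]
        gcongr
        exact Finset.sum_nonneg fun a _ => div_nonneg (sq_nonneg _) (hw a).le
    _ = _ := mul_comm _ _

/-! ### Shannon entropy -/

/-- The Boltzmann distribution. -/
def boltzmann {A : Type*} [Fintype A] (τ : ℝ) (q : A → ℝ) (a : A) : ℝ :=
  Real.exp (q a / τ) / ∑ b, Real.exp (q b / τ)

theorem boltzmann_pos {A : Type*} [Fintype A] [Nonempty A] (τ : ℝ) (q : A → ℝ) (a : A) :
    0 < boltzmann τ q a := by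
  unfold boltzmann
  have : 0 < ∑ b, Real.exp (q b / τ) :=
    Finset.sum_pos (fun b _ => Real.exp_pos _) Finset.univ_nonempty
  positivity

theorem boltzmann_mem {A : Type*} [Fintype A] [Nonempty A] (τ : ℝ) (q : A → ℝ) :
    boltzmann τ q ∈ stdSimplex ℝ A := by
  refine ⟨fun a => (boltzmann_pos τ q a).le, ?_⟩
  have : 0 < ∑ b, Real.exp (q b / τ) :=
    Finset.sum_pos (fun b _ => Real.exp_pos _) Finset.univ_nonempty
  unfold boltzmann
  rw [← Finset.sum_div, div_self this.ne']

/-- For the Shannon regularizer, the gap is a relative entropy. -/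
theorem regGap_shannonReg {A : Type*} [Fintype A] [Nonempty A] {τ : ℝ} (hτ : 0 < τ) (q : A → ℝ)
    {p' : A → ℝ} (hp' : p' ∈ stdSimplex ℝ A) :
    regGap (shannonReg τ) q (boltzmann τ q) p' =
      τ * ∑ a, p' a * (Real.log (p' a) - Real.log (boltzmann τ q a)) := by
  set L := Real.log (∑ b, Real.exp (q b / τ)) with hL
  have hZ : 0 < ∑ b, Real.exp (q b / τ) :=
    Finset.sum_pos (fun b _ => Real.exp_pos _) Finset.univ_nonempty
  have hlog : ∀ a, q a = τ * (Real.log (boltzmann τ q a) + L) := by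
    intro a
    rw [boltzmann, Real.log_div (Real.exp_pos _).ne' hZ.ne', Real.log_exp, ← hL]
    field_simp
    ring
  have hp := boltzmann_mem τ q
  have key : ∀ p ∈ stdSimplex ℝ A, ∑ a, p a * q a - shannonReg τ p =
      τ * L - τ * ∑ a, p a * (Real.log (p a) - Real.log (boltzmann τ q a)) := by
    intro p hp
    have : ∑ a, p a * q a = τ * ∑ a, p a * Real.log (boltzmann τ q a) + τ * L := by
      calc ∑ a, p a * q a = ∑ a, (τ * (p a * Real.log (boltzmann τ q a)) + τ * L * p a) :=
            Finset.sum_congr rfl fun a _ => by rw [hlog a]; ring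
        _ = _ := by rw [Finset.sum_add_distrib, ← Finset.mul_sum, ← Finset.mul_sum, hp.2, mul_one]
    rw [this]
    simp only [shannonReg, shannonEntropy, Real.negMulLog, mul_sub, Finset.sum_sub_distrib,
      neg_mul, Finset.sum_neg_distrib]
    ring
  rw [regGap, key _ hp, key _ hp']
  simp

/-- A Pinsker-type bound: relative entropy dominates the squared Hellinger distance, which dominates
a quarter of the squared ℓ¹ distance. -/
theorem isSoftmax_boltzmann {A : Type*} [Fintype A] [Nonempty A] {τ : ℝ} (hτ : 0 < τ)
    (q : A → ℝ) : IsSoftmax (shannonReg τ) τ q (boltzmann τ q) := by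
  have hp := boltzmann_mem τ q
  refine ⟨hp, fun p' hp' => ?_⟩
  rw [regGap_shannonReg hτ q hp']
  have h1 := sum_abs_sub_sq_le hp hp' (w := fun _ => 1) (by simp) (by simp)
  -- The added differences sum to zero and make the comparison termwise. It follows from log x ≤ x -
  -- 1 at x = √(p / p'), where p is the Boltzmann weight.
  have h2 : ∑ a, (√(p' a) - √(boltzmann τ q a)) ^ 2 / 1 ≤
      ∑ a, (p' a * (Real.log (p' a) - Real.log (boltzmann τ q a)) +
        (boltzmann τ q a - p' a)) := by
    refine Finset.sum_le_sum fun a _ => ?_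
    have hb := boltzmann_pos τ q a
    have hsb := Real.sqrt_pos.mpr hb
    have e2 := Real.sq_sqrt hb.le
    rcases (hp'.1 a).eq_or_lt with h0 | h0
    · rw [← h0]
      simp [e2]
    · have hs := Real.sqrt_pos.mpr h0
      have e1 := Real.sq_sqrt h0.le
      have hlog := Real.log_le_sub_one_of_pos (div_pos hsb hs)
      rw [Real.log_div hsb.ne' hs.ne', Real.log_sqrt hb.le, Real.log_sqrt h0.le] at hlog
      have h3 := mul_le_mul_of_nonneg_left hlog h0.le
      have h4 : p' a * (√(boltzmann τ q a) / √(p' a) - 1) =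
          √(p' a) * √(boltzmann τ q a) - p' a := by
        nth_rewrite 1 [← e1]
        field_simp
        rw [mul_sub, ← sq, e1]
      rw [h4] at h3
      nlinarith
  rw [Finset.sum_add_distrib, Finset.sum_sub_distrib, hp.2, hp'.2] at h2
  nlinarith

/-- Each term of the partition sum is at most exp(B/τ) times the one at a, whence the lower bound on
the weights. Relative entropy is at most the χ² divergence, again by log x ≤ x - 1, so c = 1 works.
-/
theorem isSmoothAt_boltzmann {A : Type*} [Fintype A] [Nonempty A] {τ : ℝ} (hτ : 0 < τ)
    {q : A → ℝ} {B : ℝ} (hq : ∀ a b, q a - q b ≤ B) :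
    IsSmoothAt (shannonReg τ) τ ((Fintype.card A : ℝ) * Real.exp (B / τ)) q
      (boltzmann τ q) := by
  have hp := boltzmann_mem τ q
  have hb := boltzmann_pos τ q
  have hZ : 0 < ∑ b, Real.exp (q b / τ) :=
    Finset.sum_pos (fun b _ => Real.exp_pos _) Finset.univ_nonempty
  have hlow : ∀ a, 1 ≤ (Fintype.card A : ℝ) * Real.exp (B / τ) * boltzmann τ q a := by
    intro a
    rw [boltzmann, mul_div_assoc', le_div_iff₀ hZ, one_mul, mul_assoc, ← Real.exp_add,
      ← nsmul_eq_mul, ← Finset.card_univ]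
    refine Finset.sum_le_card_nsmul _ _ _ fun b _ => Real.exp_le_exp.mpr ?_
    rw [← add_div]
    gcongr
    linarith [hq b a]
  refine ⟨fun a => ⟨hb a, hlow a⟩, 1, zero_le_one, hlow, fun p' hp' => ?_⟩
  rw [regGap_shannonReg hτ q hp', mul_one]
  refine mul_le_mul_of_nonneg_left ?_ hτ.le
  have h2 : ∑ a, p' a * (Real.log (p' a) - Real.log (boltzmann τ q a)) ≤
      ∑ a, ((p' a - boltzmann τ q a) ^ 2 / boltzmann τ q a + (p' a - boltzmann τ q a)) := by
    refine Finset.sum_le_sum fun a _ => ?_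
    have hba := hb a
    have e : (p' a - boltzmann τ q a) ^ 2 / boltzmann τ q a + (p' a - boltzmann τ q a) =
        p' a * (p' a / boltzmann τ q a - 1) := by
      field_simp
      ring
    rw [e]
    rcases (hp'.1 a).eq_or_lt with h0 | h0
    · simp [← h0]
    · rw [← Real.log_div h0.ne' hba.ne']
      exact mul_le_mul_of_nonneg_left (Real.log_le_sub_one_of_pos (div_pos h0 hba)) h0.le
  rw [Finset.sum_add_distrib, Finset.sum_sub_distrib, hp.2, hp'.2] at h2
  linarith

/-! ### Tsallis-1/2 entropy -/

/-- The normalization of the Tsallis-1/2 maximizer. -/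
theorem exists_tsallis_multiplier {A : Type*} [Fintype A] [Nonempty A] {τ : ℝ} (hτ : 0 < τ)
    (q : A → ℝ) : ∃ l : ℝ, (∃ b, l ≤ q b + τ * √(Fintype.card A : ℝ)) ∧ (∀ a, q a + τ ≤ l) ∧
      ∑ a, (τ / (l - q a)) ^ 2 = 1 := by
  obtain ⟨b, hb⟩ := Finite.exists_max q
  have hm : (1 : ℝ) ≤ √(Fintype.card A : ℝ) := by
    rw [Real.one_le_sqrt]
    exact_mod_cast Fintype.card_pos
  have hle : q b + τ ≤ q b + τ * √(Fintype.card A : ℝ) := by nlinarith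
  -- Intermediate values in l: at max q + τ the maximal action alone contributes 1, while at max q +
  -- τ√|A| every term is at most 1/|A|.
  have hcont : ContinuousOn (fun l => ∑ a, (τ / (l - q a)) ^ 2)
      (Set.Icc (q b + τ) (q b + τ * √(Fintype.card A : ℝ))) := by
    refine continuousOn_finsetSum _ fun a _ => ContinuousOn.pow (ContinuousOn.div
      continuousOn_const (by fun_prop) fun l hl => ?_) _
    have := hl.1
    have := hb a
    linarith
  have h1 : (1 : ℝ) ≤ ∑ a, (τ / (q b + τ - q a)) ^ 2 := by
    have : (τ / (q b + τ - q b)) ^ 2 = 1 := by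
      rw [add_sub_cancel_left, div_self hτ.ne', one_pow]
    rw [← this]
    exact Finset.single_le_sum (f := fun a => (τ / (q b + τ - q a)) ^ 2)
      (fun a _ => sq_nonneg _) (Finset.mem_univ b)
  have h2 : ∑ a, (τ / (q b + τ * √(Fintype.card A : ℝ) - q a)) ^ 2 ≤ 1 := by
    have hcard : (0 : ℝ) < Fintype.card A := by exact_mod_cast Fintype.card_pos
    have : ∀ a ∈ Finset.univ, (τ / (q b + τ * √(Fintype.card A : ℝ) - q a)) ^ 2 ≤
        1 / (Fintype.card A : ℝ) := by
      intro a _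
      have hba := hb a
      have hpos : 0 < τ * √(Fintype.card A : ℝ) := by positivity
      calc (τ / (q b + τ * √(Fintype.card A : ℝ) - q a)) ^ 2
          ≤ (τ / (τ * √(Fintype.card A : ℝ))) ^ 2 := by
            have : τ * √(Fintype.card A : ℝ) ≤ q b + τ * √(Fintype.card A : ℝ) - q a := by
              linarith
            have h0 : 0 < q b + τ * √(Fintype.card A : ℝ) - q a := by linarith
            gcongr
        _ = 1 / (Fintype.card A : ℝ) := by
            rw [div_pow, mul_pow, Real.sq_sqrt hcard.le]
            field_simp
    refine (Finset.sum_le_card_nsmul _ _ _ this).trans_eq ?_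
    rw [Finset.card_univ, nsmul_eq_mul]
    field_simp
  obtain ⟨l, hl, hl1⟩ := intermediate_value_Icc' hle hcont ⟨h2, h1⟩
  exact ⟨l, ⟨b, hl.2⟩, fun a => by linarith [hb a, hl.1], hl1⟩

theorem tsallisReg_eq {A : Type*} [Fintype A] (τ : ℝ) (p : A → ℝ) :
    tsallisReg τ p = 2 * τ - 2 * τ * ∑ a, √(p a) := by
  simp only [tsallisReg, tsallisEntropy, ← Real.sqrt_eq_rpow]
  ring

/-- The Tsallis-1/2 maximizer with multiplier `l`. -/
def tsallisMax {A : Type*} (τ l : ℝ) (q : A → ℝ) (a : A) : ℝ := (τ / (l - q a)) ^ 2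

/-- Stationarity reads q + τ/√p = l, so the gap is the Bregman divergence of -2τ∑√p. The terms in l
cancel because both distributions have mass one. -/
theorem regGap_tsallisReg {A : Type*} [Fintype A] {τ l : ℝ} (hτ : 0 < τ) {q : A → ℝ}
    (hl : ∀ a, q a + τ ≤ l) (hl1 : ∑ a, tsallisMax τ l q a = 1) {p' : A → ℝ}
    (hp' : p' ∈ stdSimplex ℝ A) :
    regGap (tsallisReg τ) q (tsallisMax τ l q) p' =
      τ * ∑ a, (√(p' a) - √(tsallisMax τ l q a)) ^ 2 / √(tsallisMax τ l q a) := by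
  have hpos : ∀ a, 0 < τ / (l - q a) := fun a => div_pos hτ (by linarith [hl a])
  have hsq : ∀ a, √(tsallisMax τ l q a) = τ / (l - q a) := fun a =>
    Real.sqrt_sq (hpos a).le
  have hterm : ∀ a, τ * ((√(p' a) - √(tsallisMax τ l q a)) ^ 2 / √(tsallisMax τ l q a)) =
      l * p' a - p' a * q a - 2 * τ * √(p' a) + 2 * τ * √(tsallisMax τ l q a) -
        (l * tsallisMax τ l q a - tsallisMax τ l q a * q a) := by
    intro a
    have h0 : l - q a ≠ 0 := by linarith [hl a]
    rw [hsq, tsallisMax]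
    have e1 := Real.sq_sqrt (hp'.1 a)
    field_simp
    linear_combination (l - q a) ^ 2 * e1
  rw [Finset.mul_sum Finset.univ (fun a => (√(p' a) - √(tsallisMax τ l q a)) ^ 2 /
    √(tsallisMax τ l q a)), Finset.sum_congr rfl fun a _ => hterm a, regGap, tsallisReg_eq,
    tsallisReg_eq]
  simp only [Finset.sum_sub_distrib, Finset.sum_add_distrib, ← Finset.mul_sum, hl1, hp'.2]
  ring

/-- Since l - q(a) ≤ B + τ√|A|, the number K = √|A| + B/τ bounds 1/√p. The gap is then at most τK
times the χ² divergence, so c = K; the condition c ≤ κp with p ≥ K⁻² leads to κ = K³. -/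
theorem exists_tsallis_isSoftmax_isSmoothAt {A : Type*} [Fintype A] [Nonempty A] {τ : ℝ}
    (hτ : 0 < τ) (q : A → ℝ) :
    ∃ p, IsSoftmax (tsallisReg τ) τ q p ∧ ∀ B : ℝ, (∀ a b, q a - q b ≤ B) →
      IsSmoothAt (tsallisReg τ) τ ((√(Fintype.card A : ℝ) + B / τ) ^ 3) q p := by
  obtain ⟨l, ⟨b, hlb⟩, hl, hl1⟩ := exists_tsallis_multiplier hτ q
  have hpos : ∀ a, 0 < τ / (l - q a) := fun a => div_pos hτ (by linarith [hl a])
  have hle : ∀ a, τ / (l - q a) ≤ 1 := fun a => by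
    rw [div_le_one (by linarith [hl a])]
    linarith [hl a]
  have hsq : ∀ a, √(tsallisMax τ l q a) = τ / (l - q a) := fun a =>
    Real.sqrt_sq (hpos a).le
  have hp : tsallisMax τ l q ∈ stdSimplex ℝ A := ⟨fun a => sq_nonneg _, hl1⟩
  refine ⟨tsallisMax τ l q, ⟨hp, fun p' hp' => ?_⟩, fun B hB => ?_⟩
  · rw [regGap_tsallisReg hτ hl hl1 hp']
    have := sum_abs_sub_sq_le hp hp' (w := fun a => √(tsallisMax τ l q a))
      (fun a => by rw [hsq]; exact hpos a) (fun a => by rw [hsq]; exact hle a)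
    nlinarith
  · set K := √(Fintype.card A : ℝ) + B / τ with hK
    have hKx : ∀ a, 1 ≤ K * (τ / (l - q a)) := by
      intro a
      have h0 : 0 < l - q a := by linarith [hl a]
      rw [mul_div_assoc', le_div_iff₀ h0, one_mul, hK, add_mul, div_mul_cancel₀ _ hτ.ne']
      linarith [hB b a]
    have hK0 : 1 ≤ K := by
      have := hKx b
      have := hle b
      have := hpos b
      by_contra! h
      nlinarith
    refine ⟨fun a => ⟨pow_pos (hpos a) 2, ?_⟩, K, by linarith, fun a => ?_, fun p' hp' => ?_⟩
    · calc (1 : ℝ) ≤ K * (K * (τ / (l - q a))) ^ 2 := by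
            nlinarith [one_le_pow₀ (hKx a) (n := 2)]
        _ = K ^ 3 * tsallisMax τ l q a := by rw [tsallisMax]; ring
    · calc K ≤ K * (K * (τ / (l - q a))) ^ 2 := by
            nlinarith [one_le_pow₀ (hKx a) (n := 2)]
        _ = K ^ 3 * tsallisMax τ l q a := by rw [tsallisMax]; ring
    · rw [regGap_tsallisReg hτ hl hl1 hp', mul_assoc]
      refine mul_le_mul_of_nonneg_left ?_ hτ.le
      rw [Finset.mul_sum]
      refine Finset.sum_le_sum fun a _ => ?_
      have hx := hpos a
      have h1 : (√(p' a) - √(tsallisMax τ l q a)) ^ 2 * tsallisMax τ l q a ≤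
          (p' a - tsallisMax τ l q a) ^ 2 := by
        have e1 := Real.sq_sqrt (hp'.1 a)
        have e2 := Real.sq_sqrt (hp.1 a)
        have hs := Real.sqrt_nonneg (p' a)
        have hs' := Real.sqrt_nonneg (tsallisMax τ l q a)
        have e3 : (p' a - tsallisMax τ l q a) ^ 2 =
            (√(p' a) - √(tsallisMax τ l q a)) ^ 2 * (√(p' a) + √(tsallisMax τ l q a)) ^ 2 := by
          rw [← mul_pow]
          congr 1
          nlinarith
        rw [e3]
        refine mul_le_mul_of_nonneg_left ?_ (sq_nonneg _)
        nlinarith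
      have hM : 0 < tsallisMax τ l q a := pow_pos hx 2
      rw [hsq, mul_div_assoc', div_le_div_iff₀ hx hM, ← hsq a]
      rw [← hsq a] at hx
      calc (√(p' a) - √(tsallisMax τ l q a)) ^ 2 * tsallisMax τ l q a
          ≤ (p' a - tsallisMax τ l q a) ^ 2 * 1 := by rw [mul_one]; exact h1
        _ ≤ (p' a - tsallisMax τ l q a) ^ 2 * (K * √(tsallisMax τ l q a)) := by
            refine mul_le_mul_of_nonneg_left ?_ (sq_nonneg _)
            rw [hsq]
            exact hKx a
        _ = _ := by ring

/-! ### Averages over the simplex -/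

theorem stdSimplex_avg_le {S : Type*} [Fintype S] {p v : S → ℝ} (hp : p ∈ stdSimplex ℝ S) {M : ℝ}
    (hv : ∀ s, v s ≤ M) : ∑ s, p s * v s ≤ M := by
  calc ∑ s, p s * v s ≤ ∑ s, p s * M :=
        Finset.sum_le_sum fun s _ => mul_le_mul_of_nonneg_left (hv s) (hp.1 s)
    _ = M := by rw [← Finset.sum_mul, hp.2, one_mul]

theorem le_stdSimplex_avg {S : Type*} [Fintype S] {p v : S → ℝ} (hp : p ∈ stdSimplex ℝ S) {m : ℝ}
    (hv : ∀ s, m ≤ v s) : m ≤ ∑ s, p s * v s := by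
  calc m = ∑ s, p s * m := by rw [← Finset.sum_mul, hp.2, one_mul]
    _ ≤ _ := Finset.sum_le_sum fun s _ => mul_le_mul_of_nonneg_left (hv s) (hp.1 s)

theorem IsSoftmax.regGap_nonneg {A : Type*} [Fintype A] {h : (A → ℝ) → ℝ} {τ : ℝ} (hτ : 0 < τ)
    {q p p' : A → ℝ} (hp : IsSoftmax h τ q p) (hp' : p' ∈ stdSimplex ℝ A) :
    0 ≤ regGap h q p p' :=
  le_trans (by positivity) (hp.2 p' hp')

/-- The optimal value of the regularized problem is `1`-Lipschitz. -/
theorem IsSoftmax.value_sub_le {A : Type*} [Fintype A] {h : (A → ℝ) → ℝ} {τ : ℝ} (hτ : 0 < τ)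
    {q q' p p' : A → ℝ} (hp : p ∈ stdSimplex ℝ A) (hp' : IsSoftmax h τ q' p') {B : ℝ}
    (hB : ∀ a, q a - q' a ≤ B) :
    (∑ a, p a * q a - h p) - (∑ a, p' a * q' a - h p') ≤ B := by
  have h1 := hp'.regGap_nonneg hτ hp
  have h2 := stdSimplex_avg_le hp hB
  simp only [mul_sub, Finset.sum_sub_distrib] at h2
  unfold regGap at h1
  linarith

/-! ### The regularized Bellman equation -/

/-- The action values `r + γ P v`. -/
def actionValue {S A : Type*} [Fintype S] (γ : ℝ) (P : TransitionLaw S A)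
    (r : EuclideanSpace ℝ (S × A)) (v : S → ℝ) (s : S) (a : A) : ℝ :=
  r (s, a) + γ * ∑ s', (P s a).1 s' * v s'

/-- The value function `v` and the policy `π` solve the regularized Bellman optimality equation. -/
def IsBellmanSolution {S A : Type*} [Fintype S] [Fintype A] (h : (A → ℝ) → ℝ) (τ γ : ℝ)
    (P : TransitionLaw S A) (r : EuclideanSpace ℝ (S × A)) (v : S → ℝ) (π : S → A → ℝ) : Prop :=
  ∀ s, IsSoftmax h τ (actionValue γ P r v s) (π s) ∧
    v s = ∑ a, π s a * actionValue γ P r v s a - h (π s)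

/-- Banach's theorem: action values are γ-Lipschitz in v for the sup norm and the regularized
maximum is 1-Lipschitz in them, so the Bellman operator is a contraction. -/
theorem exists_isBellmanSolution {S A : Type*} [Fintype S] [Fintype A] {h : (A → ℝ) → ℝ}
    {τ γ : ℝ} (hτ : 0 < τ) (hγ0 : 0 ≤ γ) (hγ1 : γ < 1) (f : (A → ℝ) → A → ℝ)
    (hf : ∀ q, IsSoftmax h τ q (f q)) (P : TransitionLaw S A) (r : EuclideanSpace ℝ (S × A)) :
    ∃ v, IsBellmanSolution h τ γ P r v (fun s => f (actionValue γ P r v s)) := by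
  set T : (S → ℝ) → (S → ℝ) := fun v s =>
    ∑ a, f (actionValue γ P r v s) a * actionValue γ P r v s a - h (f (actionValue γ P r v s))
  have hQ : ∀ (v w : S → ℝ) s a,
      actionValue γ P r v s a - actionValue γ P r w s a ≤ γ * dist v w := by
    intro v w s a
    have : ∑ s', (P s a).1 s' * (v s' - w s') ≤ dist v w := by
      refine stdSimplex_avg_le (P s a).2 fun s' => ?_
      have h1 := dist_le_pi_dist v w s'
      rw [Real.dist_eq] at h1
      exact (le_abs_self _).trans h1
    simp only [mul_sub, Finset.sum_sub_distrib] at this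
    unfold actionValue
    nlinarith
  have hT : ContractingWith ⟨γ, hγ0⟩ T := by
    refine ⟨by exact_mod_cast hγ1, LipschitzWith.of_dist_le_mul fun v w => ?_⟩
    refine (dist_pi_le_iff (by positivity)).mpr fun s => ?_
    rw [Real.dist_eq, abs_sub_le_iff]
    refine ⟨(hf _).value_sub_le hτ (hf _).1 (hQ v w s), ?_⟩
    rw [dist_comm]
    exact (hf _).value_sub_le hτ (hf _).1 (hQ w v s)
  refine ⟨ContractingWith.fixedPoint T hT, fun s => ⟨hf _, ?_⟩⟩
  exact (congrFun hT.fixedPoint_isFixedPt s).symm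

/-- Action values at a Bellman solution have span at most `2 R H_γ`. -/
theorem IsBellmanSolution.actionValue_sub_le {S A : Type*} [Fintype S] [Nonempty S] [Fintype A]
    {h : (A → ℝ) → ℝ} {τ γ : ℝ} (hτ : 0 < τ) (hγ0 : 0 ≤ γ) (hγ1 : γ < 1) {P : TransitionLaw S A}
    {r : EuclideanSpace ℝ (S × A)} {v : S → ℝ} {π : S → A → ℝ}
    (hv : IsBellmanSolution h τ γ P r v π) {R : ℝ} (hR : ∀ x, |r x| ≤ R) (s : S) (a b : A) :
    actionValue γ P r v s a - actionValue γ P r v s b ≤ 2 * R * effHorizon γ := by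
  obtain ⟨s₁, h₁⟩ := Finite.exists_max v
  obtain ⟨s₀, h₀⟩ := Finite.exists_min v
  have hQ : ∀ s a s' b, actionValue γ P r v s a - actionValue γ P r v s' b ≤
      2 * R + γ * (v s₁ - v s₀) := by
    intro s a s' b
    have e1 := stdSimplex_avg_le (P s a).2 h₁
    have e2 := le_stdSimplex_avg (P s' b).2 h₀
    have e3 := abs_le.mp (hR (s, a))
    have e4 := abs_le.mp (hR (s', b))
    unfold actionValue
    nlinarith
  -- The bound on action values holds across states, so it also bounds the span of v. Solving gives
  -- span at most 2RH_γ, and 2R + γ · 2RH_γ = 2RH_γ.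
  have hspan : v s₁ - v s₀ ≤ 2 * R + γ * (v s₁ - v s₀) := by
    conv_lhs => rw [(hv s₁).2, (hv s₀).2]
    exact (hv s₀).1.value_sub_le hτ (hv s₁).1.1 fun a => hQ _ _ _ _
  refine (hQ s a s b).trans ?_
  have h1 : 0 < 1 - γ := by linarith
  rw [effHorizon, mul_one_div, le_div_iff₀ h1]
  nlinarith

/-! ### Occupancy measures -/

theorem inner_prod_eq_sum {S A : Type*} [Fintype S] [Fintype A]
    (x y : EuclideanSpace ℝ (S × A)) : inner ℝ x y = ∑ s, ∑ a, x (s, a) * y (s, a) := by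
  rw [PiLp.inner_apply, Fintype.sum_prod_type]
  simp [mul_comm]

/-- The adjoint of E - γP is the Bellman flow operator. Hence the flow constraints prescribe exactly
the pairings of μ with U_P. -/
theorem inner_shaping {S A : Type*} [Fintype S] [Fintype A] (γ : ℝ) (P : TransitionLaw S A)
    (v : S → ℝ) (μ : EuclideanSpace ℝ (S × A)) :
    inner ℝ ((liftOp S A - γ • transOp P) v) μ =
      ∑ s, v s * (stateMarginal μ s - γ * ∑ s', ∑ a', (P s' a').1 s * μ (s', a')) := by
  have h1 : ∀ s a, ((liftOp S A - γ • transOp P) v) (s, a) =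
      v s - γ * ∑ s', (P s a).1 s' * v s' := fun s a => rfl
  rw [inner_prod_eq_sum]
  simp_rw [h1, mul_sub, sub_mul, Finset.sum_sub_distrib, stateMarginal, Finset.mul_sum,
    Finset.sum_mul]
  congr 1
  have h2 : ∀ s, ∑ a, ∑ s', γ * ((P s a).1 s' * v s') * μ (s, a) =
      ∑ s', ∑ a, γ * ((P s a).1 s' * v s') * μ (s, a) := fun s => Finset.sum_comm
  simp_rw [h2]
  rw [Finset.sum_comm]
  refine Finset.sum_congr rfl fun s _ => Finset.sum_congr rfl fun s' _ =>
    Finset.sum_congr rfl fun a _ => by ring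

theorem inner_shaping_of_mem {S A : Type*} [Fintype S] [Fintype A] {γ : ℝ} {ν₀ : S → ℝ}
    {P : TransitionLaw S A} {μ : EuclideanSpace ℝ (S × A)} (hμ : μ ∈ occupancySet γ ν₀ P)
    (v : S → ℝ) :
    inner ℝ ((liftOp S A - γ • transOp P) v) μ = (1 - γ) * ∑ s, v s * ν₀ s := by
  rw [inner_shaping, Finset.mul_sum]
  refine Finset.sum_congr rfl fun s _ => ?_
  rw [hμ.2 s]
  ring

/-- Occupancy measures are stable under nonnegative perturbations orthogonal to `U_P`. -/
theorem add_mem_occupancySet {S A : Type*} [Fintype S] [Fintype A] {γ : ℝ} {ν₀ : S → ℝ}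
    {P : TransitionLaw S A} {μ d : EuclideanSpace ℝ (S × A)} (hμ : μ ∈ occupancySet γ ν₀ P)
    (hd : d ∈ (shapingSpace γ P)ᗮ) (h0 : ∀ x, 0 ≤ (μ + d) x) :
    μ + d ∈ occupancySet γ ν₀ P := by
  classical
  refine ⟨h0, fun s => ?_⟩
  -- Testing against the indicator of s isolates the flow constraint at s.
  have h1 := (Submodule.mem_orthogonal _ _).mp hd _
    (LinearMap.mem_range_self (liftOp S A - γ • transOp P) (Pi.single s 1))
  have h2 := inner_shaping_of_mem hμ (Pi.single s 1)
  have h3 := inner_shaping γ P (Pi.single s 1) (μ + d)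
  rw [inner_add_right, h1, h2] at h3
  simpa [Pi.single_apply] using h3.symm

/-- The constant function `1` on state-action pairs. -/
def oneVec (S A : Type*) : EuclideanSpace ℝ (S × A) := WithLp.toLp 2 fun _ => 1

theorem shaping_one {S A : Type*} [Fintype S] (γ : ℝ) (P : TransitionLaw S A) :
    (liftOp S A - γ • transOp P) (fun _ => 1) = (1 - γ) • oneVec S A := by
  ext ⟨s, a⟩
  have : ((liftOp S A - γ • transOp P) (fun _ => 1)) (s, a) =
      1 - γ * ∑ s', (P s a).1 s' * 1 := rfl
  rw [this]
  simp [oneVec, (P s a).2.2]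

/-- The constants form the common line to which the angle estimate is applied. -/
theorem oneVec_mem_shapingSpace {S A : Type*} [Fintype S] {γ : ℝ} (hγ1 : γ < 1)
    (P : TransitionLaw S A) : oneVec S A ∈ shapingSpace γ P := by
  refine ⟨(1 - γ)⁻¹ • fun _ => 1, ?_⟩
  have : 1 - γ ≠ 0 := by linarith
  rw [map_smul, shaping_one, smul_smul, inv_mul_cancel₀ this, one_smul]

theorem inner_oneVec {S A : Type*} [Fintype S] [Fintype A] {γ : ℝ} (hγ1 : γ < 1) {ν₀ : S → ℝ}
    (hν₀ : ν₀ ∈ stdSimplex ℝ S) {P : TransitionLaw S A} {μ : EuclideanSpace ℝ (S × A)}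
    (hμ : μ ∈ occupancySet γ ν₀ P) : inner ℝ (oneVec S A) μ = 1 := by
  have h := inner_shaping_of_mem hμ (fun _ => 1)
  rw [shaping_one, real_inner_smul_left] at h
  simp only [one_mul, hν₀.2] at h
  exact mul_left_cancel₀ (by linarith : 1 - γ ≠ 0) h

theorem sum_stateMarginal {S A : Type*} [Fintype S] [Fintype A] {γ : ℝ} (hγ1 : γ < 1)
    {ν₀ : S → ℝ} (hν₀ : ν₀ ∈ stdSimplex ℝ S) {P : TransitionLaw S A}
    {μ : EuclideanSpace ℝ (S × A)} (hμ : μ ∈ occupancySet γ ν₀ P) :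
    ∑ s, stateMarginal μ s = 1 := by
  rw [← inner_oneVec hγ1 hν₀ hμ, inner_prod_eq_sum]
  simp [oneVec, stateMarginal]

theorem stateMarginal_nonneg {S A : Type*} [Fintype A] {μ : EuclideanSpace ℝ (S × A)}
    (hμ : ∀ x, 0 ≤ μ x) (s : S) : 0 ≤ stateMarginal μ s :=
  Finset.sum_nonneg fun _ _ => hμ _

theorem policyOf_mem {S A : Type*} [Fintype A] [Nonempty A] {μ : EuclideanSpace ℝ (S × A)}
    (hμ : ∀ x, 0 ≤ μ x) (s : S) : policyOf μ s ∈ stdSimplex ℝ A := by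
  unfold policyOf
  split_ifs with h
  · exact ⟨fun a => div_nonneg (hμ _) h.le, by
      rw [← Finset.sum_div, ← stateMarginal, div_self h.ne']⟩
  · exact ⟨fun a => by positivity, by simp⟩

/-- This also holds at states of zero marginal, where μ vanishes, so the arbitrary default policy is
harmless. -/
theorem stateMarginal_mul_policyOf {S A : Type*} [Fintype A] {μ : EuclideanSpace ℝ (S × A)}
    (hμ : ∀ x, 0 ≤ μ x) (s : S) (a : A) : stateMarginal μ s * policyOf μ s a = μ (s, a) := by
  unfold policyOf
  split_ifs with h
  · field_simp
  · have h0 : stateMarginal μ s = 0 := le_antisymm (not_lt.mp h) (stateMarginal_nonneg hμ s)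
    rw [h0, zero_mul]
    exact ((Finset.sum_eq_zero_iff_of_nonneg fun a _ => hμ (s, a)).mp h0 a (Finset.mem_univ a)).symm

theorem occReg_eq {S A : Type*} [Fintype S] [Fintype A] (h : (A → ℝ) → ℝ)
    (μ : EuclideanSpace ℝ (S × A)) :
    occReg h μ = ∑ s, stateMarginal μ s * h (policyOf μ s) := by
  simp only [occReg, stateMarginal, Finset.sum_mul]

/-- Every policy has an occupancy measure. -/
theorem exists_mem_occupancySet {S A : Type*} [Fintype S] [Fintype A] {γ : ℝ} (hγ0 : 0 ≤ γ)
    (hγ1 : γ < 1) {ν₀ : S → ℝ} (hν₀ : ∀ s, 0 ≤ ν₀ s) (P : TransitionLaw S A) {π : S → A → ℝ}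
    (hπ : ∀ s, π s ∈ stdSimplex ℝ A) :
    ∃ μ ∈ occupancySet γ ν₀ P, ∀ s a, μ (s, a) = stateMarginal μ s * π s a := by
  set K : S → S → ℝ := fun s s' => ∑ a, (P s' a).1 s * π s' a with hK
  have hK0 : ∀ s s', 0 ≤ K s s' := fun s s' =>
    Finset.sum_nonneg fun a _ => mul_nonneg ((P s' a).2.1 s) ((hπ s').1 a)
  have hK1 : ∀ s', ∑ s, K s s' = 1 := by
    intro s'
    rw [hK, Finset.sum_comm]
    simp_rw [← Finset.sum_mul, (P s' _).2.2, one_mul]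
    exact (hπ s').2
  have hsum : ∀ w : S → ℝ, ∑ s, ∑ s', K s s' * w s' = ∑ s, w s := by
    intro w
    rw [Finset.sum_comm]
    simp_rw [← Finset.sum_mul, hK1, one_mul]
  -- Summing over s, with column sums of K equal to one, gives ∑w ≤ γ∑w. Applied to |w| this yields
  -- injectivity of id - γK; applied to the negative part of the solution it yields nonnegativity.
  have hzero : ∀ w : S → ℝ, (∀ s, 0 ≤ w s) → (∀ s, w s ≤ γ * ∑ s', K s s' * w s') →
      ∀ s, w s = 0 := by
    intro w hw0 hw s
    have h1 := Finset.sum_le_sum fun s (_ : s ∈ Finset.univ) => hw s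
    rw [← Finset.mul_sum, hsum] at h1
    have h2 : 0 ≤ ∑ s, w s := Finset.sum_nonneg fun s _ => hw0 s
    have h3 : ∑ s, w s = 0 := by nlinarith
    exact (Finset.sum_eq_zero_iff_of_nonneg fun s _ => hw0 s).mp h3 s (Finset.mem_univ s)
  set T : (S → ℝ) →ₗ[ℝ] (S → ℝ) := LinearMap.id - γ • Matrix.mulVecLin (Matrix.of K) with hT
  have hTa : ∀ w s, T w s = w s - γ * ∑ s', K s s' * w s' := fun w s => rfl
  have hinj : Function.Injective T := by
    rw [injective_iff_map_eq_zero]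
    intro w hw
    have : ∀ s, |w s| = 0 := by
      refine hzero (fun s => |w s|) (fun s => abs_nonneg _) fun s => ?_
      have h1 := hTa w s
      rw [hw, Pi.zero_apply] at h1
      have h2 : w s = γ * ∑ s', K s s' * w s' := by linarith
      calc |w s| = γ * |∑ s', K s s' * w s'| := by
            conv_lhs => rw [h2, abs_mul, abs_of_nonneg hγ0]
        _ ≤ γ * ∑ s', |K s s' * w s'| :=
            mul_le_mul_of_nonneg_left (Finset.abs_sum_le_sum_abs _ _) hγ0
        _ = _ := by simp_rw [abs_mul, abs_of_nonneg (hK0 s _)]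
    ext s
    exact abs_eq_zero.mp (this s)
  obtain ⟨ν, hν⟩ := LinearMap.injective_iff_surjective.mp hinj fun s => (1 - γ) * ν₀ s
  have hν' : ∀ s, ν s - γ * ∑ s', K s s' * ν s' = (1 - γ) * ν₀ s := fun s => by
    rw [← hTa, hν]
  have hneg : ∀ s, max (-ν s) 0 = 0 := by
    refine hzero (fun s => max (-ν s) 0) (fun s => le_max_right _ _) fun s => ?_
    have h0 : 0 ≤ ∑ s', K s s' * max (-ν s') 0 :=
      Finset.sum_nonneg fun s' _ => mul_nonneg (hK0 s s') (le_max_right _ _)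
    refine max_le ?_ (mul_nonneg hγ0 h0)
    have h1 : ∑ s', K s s' * (-ν s') ≤ ∑ s', K s s' * max (-ν s') 0 :=
      Finset.sum_le_sum fun s' _ => mul_le_mul_of_nonneg_left (le_max_left _ _) (hK0 s s')
    simp only [mul_neg, Finset.sum_neg_distrib] at h1
    have h2 := hν' s
    have h3 := hν₀ s
    nlinarith
  have hν0 : ∀ s, 0 ≤ ν s := fun s => by
    have := max_eq_right_iff.mp (hneg s)
    linarith
  have hmarg : ∀ s, stateMarginal (WithLp.toLp 2 fun x : S × A => ν x.1 * π x.1 x.2) s = ν s := by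
    intro s
    simp only [stateMarginal]
    rw [← Finset.mul_sum, (hπ s).2, mul_one]
  refine ⟨WithLp.toLp 2 fun x => ν x.1 * π x.1 x.2,
    ⟨fun x => mul_nonneg (hν0 _) ((hπ _).1 _), fun s => ?_⟩, fun s a => by rw [hmarg]⟩
  rw [hmarg, ← hν' s]
  congr 2
  refine Finset.sum_congr rfl fun s' _ => ?_
  rw [hK, Finset.sum_mul]
  exact Finset.sum_congr rfl fun a _ => by simp only []; ring

/-- Occupancy measures with policies `π` and `π'` differ in `ℓ¹` by at most `H_γ` times the average
distance of `π` and `π'`. -/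
theorem sum_abs_sub_le {S A : Type*} [Fintype S] [Fintype A] [Nonempty A] {γ : ℝ} (hγ0 : 0 ≤ γ)
    (hγ1 : γ < 1) {ν₀ : S → ℝ} {P : TransitionLaw S A} {μ μ' : EuclideanSpace ℝ (S × A)}
    (hμ : μ ∈ occupancySet γ ν₀ P) (hμ' : μ' ∈ occupancySet γ ν₀ P) {π : S → A → ℝ}
    (hπ : ∀ s, π s ∈ stdSimplex ℝ A) (hμπ : ∀ s a, μ' (s, a) = stateMarginal μ' s * π s a) :
    ∑ s, ∑ a, |μ (s, a) - μ' (s, a)| ≤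
      effHorizon γ * ∑ s, stateMarginal μ s * ∑ a, |policyOf μ s a - π s a| := by
  set N := ∑ s, ∑ a, |μ (s, a) - μ' (s, a)| with hN
  set X := ∑ s, stateMarginal μ s * ∑ a, |policyOf μ s a - π s a| with hX
  -- Subtracting the two flow constraints shows that the marginals differ by at most γN. With N ≤ X
  -- + γN below, this gives the factor H_γ.
  have h1 : ∑ s, |stateMarginal μ s - stateMarginal μ' s| ≤ γ * N := by
    have e : ∀ s, |stateMarginal μ s - stateMarginal μ' s| ≤
        γ * ∑ s', ∑ a', (P s' a').1 s * |μ (s', a') - μ' (s', a')| := by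
      intro s
      have e1 : stateMarginal μ s - stateMarginal μ' s =
          γ * ∑ s', ∑ a', (P s' a').1 s * (μ (s', a') - μ' (s', a')) := by
        have := hμ.2 s
        have := hμ'.2 s
        simp only [mul_sub, Finset.sum_sub_distrib]
        linarith
      rw [e1, abs_mul, abs_of_nonneg hγ0]
      refine mul_le_mul_of_nonneg_left ?_ hγ0
      refine (Finset.abs_sum_le_sum_abs _ _).trans (Finset.sum_le_sum fun s' _ => ?_)
      refine (Finset.abs_sum_le_sum_abs _ _).trans (Finset.sum_le_sum fun a' _ => ?_)
      rw [abs_mul, abs_of_nonneg ((P s' a').2.1 s)]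
    refine (Finset.sum_le_sum fun s _ => e s).trans_eq ?_
    rw [← Finset.mul_sum, Finset.sum_comm]
    congr 1
    refine Finset.sum_congr rfl fun s' _ => ?_
    rw [Finset.sum_comm]
    refine Finset.sum_congr rfl fun a' _ => ?_
    rw [← Finset.sum_mul, (P s' a').2.2, one_mul]
  have h2 : N ≤ X + ∑ s, |stateMarginal μ s - stateMarginal μ' s| := by
    rw [hN, hX, ← Finset.sum_add_distrib]
    refine Finset.sum_le_sum fun s _ => ?_
    have e0 := stateMarginal_nonneg hμ.1 s
    calc ∑ a, |μ (s, a) - μ' (s, a)|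
        ≤ ∑ a, (stateMarginal μ s * |policyOf μ s a - π s a| +
            |stateMarginal μ s - stateMarginal μ' s| * π s a) := by
          refine Finset.sum_le_sum fun a _ => ?_
          have e1 : μ (s, a) - μ' (s, a) = stateMarginal μ s * (policyOf μ s a - π s a) +
              (stateMarginal μ s - stateMarginal μ' s) * π s a := by
            rw [hμπ, ← stateMarginal_mul_policyOf hμ.1]
            ring
          rw [e1]
          refine (abs_add_le _ _).trans_eq ?_
          rw [abs_mul, abs_mul, abs_of_nonneg e0, abs_of_nonneg ((hπ s).1 a)]
      _ = _ := by
          rw [Finset.sum_add_distrib, ← Finset.mul_sum, ← Finset.mul_sum, (hπ s).2, mul_one]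
  have h3 : 0 < 1 - γ := by linarith
  rw [effHorizon, one_div_mul_eq_div, le_div_iff₀ h3]
  linarith

/-! ### Optimal occupancy measures -/

theorem objective_sub_objective {S A : Type*} [Fintype S] [Fintype A] (h : (A → ℝ) → ℝ)
    (r r' μ : EuclideanSpace ℝ (S × A)) :
    objective h r μ - objective h r' μ = inner ℝ (r - r') μ := by
  rw [objective, objective, inner_sub_left]
  ring

/-- The performance difference formula. -/
theorem IsBellmanSolution.objective_eq {S A : Type*} [Fintype S] [Fintype A]
    {h : (A → ℝ) → ℝ} {τ γ : ℝ} {P : TransitionLaw S A} {r : EuclideanSpace ℝ (S × A)}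
    {v : S → ℝ} {π : S → A → ℝ} (hv : IsBellmanSolution h τ γ P r v π) {ν₀ : S → ℝ}
    {μ : EuclideanSpace ℝ (S × A)} (hμ : μ ∈ occupancySet γ ν₀ P) :
    objective h r μ = (1 - γ) * ∑ s, v s * ν₀ s -
      ∑ s, stateMarginal μ s * regGap h (actionValue γ P r v s) (π s) (policyOf μ s) := by
  have h1 : ∀ s, stateMarginal μ s * regGap h (actionValue γ P r v s) (π s) (policyOf μ s) =
      ∑ a, ((liftOp S A - γ • transOp P) v) (s, a) * μ (s, a) - ∑ a, r (s, a) * μ (s, a) +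
        stateMarginal μ s * h (policyOf μ s) := by
    intro s
    have e1 : ∀ a, ((liftOp S A - γ • transOp P) v) (s, a) =
        v s - γ * ∑ s', (P s a).1 s' * v s' := fun a => rfl
    have e2 : stateMarginal μ s * ∑ a, policyOf μ s a * actionValue γ P r v s a =
        ∑ a, μ (s, a) * actionValue γ P r v s a := by
      rw [Finset.mul_sum]
      refine Finset.sum_congr rfl fun a _ => ?_
      rw [← mul_assoc, stateMarginal_mul_policyOf hμ.1]
    have e3 : ∑ a, ((liftOp S A - γ • transOp P) v) (s, a) * μ (s, a) -
        ∑ a, r (s, a) * μ (s, a) =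
        stateMarginal μ s * v s - ∑ a, μ (s, a) * actionValue γ P r v s a := by
      rw [stateMarginal, Finset.sum_mul, ← Finset.sum_sub_distrib, ← Finset.sum_sub_distrib]
      refine Finset.sum_congr rfl fun a _ => ?_
      rw [e1, actionValue]
      ring
    rw [e3, ← e2, regGap, ← (hv s).2]
    ring
  simp_rw [h1]
  rw [Finset.sum_add_distrib, Finset.sum_sub_distrib, ← inner_prod_eq_sum, ← inner_prod_eq_sum,
    inner_shaping_of_mem hμ, ← occReg_eq, objective]
  ring

theorem IsBellmanSolution.objective_le {S A : Type*} [Fintype S] [Fintype A] [Nonempty A]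
    {h : (A → ℝ) → ℝ} {τ γ : ℝ} (hτ : 0 < τ) {P : TransitionLaw S A}
    {r : EuclideanSpace ℝ (S × A)} {v : S → ℝ} {π : S → A → ℝ}
    (hv : IsBellmanSolution h τ γ P r v π) {ν₀ : S → ℝ}
    {μ : EuclideanSpace ℝ (S × A)} (hμ : μ ∈ occupancySet γ ν₀ P) :
    objective h r μ ≤ (1 - γ) * ∑ s, v s * ν₀ s := by
  rw [hv.objective_eq hμ, sub_le_self_iff]
  exact Finset.sum_nonneg fun s _ => mul_nonneg (stateMarginal_nonneg hμ.1 s)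
    ((hv s).1.regGap_nonneg hτ (policyOf_mem hμ.1 s))

/-- All gaps vanish at an occupancy measure of the Bellman policy; unvisited states carry weight
zero. -/
theorem IsBellmanSolution.exists_objective_eq {S A : Type*} [Fintype S] [Fintype A]
    {h : (A → ℝ) → ℝ} {τ γ : ℝ} (hγ0 : 0 ≤ γ) (hγ1 : γ < 1)
    {P : TransitionLaw S A} {r : EuclideanSpace ℝ (S × A)} {v : S → ℝ} {π : S → A → ℝ}
    (hv : IsBellmanSolution h τ γ P r v π) {ν₀ : S → ℝ} (hν₀ : ∀ s, 0 ≤ ν₀ s) :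
    ∃ μ ∈ occupancySet γ ν₀ P, objective h r μ = (1 - γ) * ∑ s, v s * ν₀ s := by
  obtain ⟨μ, hμ, hμπ⟩ := exists_mem_occupancySet hγ0 hγ1 hν₀ P fun s => (hv s).1.1
  refine ⟨μ, hμ, ?_⟩
  rw [hv.objective_eq hμ, sub_eq_self]
  refine Finset.sum_eq_zero fun s _ => ?_
  rcases (stateMarginal_nonneg hμ.1 s).eq_or_lt with h0 | h0
  · rw [← h0, zero_mul]
  · have : policyOf μ s = π s := by
      ext a
      refine mul_left_cancel₀ h0.ne' ?_
      rw [stateMarginal_mul_policyOf hμ.1, hμπ]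
    rw [this, regGap, sub_self, mul_zero]

theorem IsBellmanSolution.subOpt_eq {S A : Type*} [Fintype S] [Fintype A] [Nonempty A]
    {h : (A → ℝ) → ℝ} {τ γ : ℝ} (hτ : 0 < τ) (hγ0 : 0 ≤ γ) (hγ1 : γ < 1)
    {P : TransitionLaw S A} {r : EuclideanSpace ℝ (S × A)} {v : S → ℝ} {π : S → A → ℝ}
    (hv : IsBellmanSolution h τ γ P r v π) {ν₀ : S → ℝ} (hν₀ : ∀ s, 0 ≤ ν₀ s)
    (μ : EuclideanSpace ℝ (S × A)) :
    subOpt γ ν₀ h P r μ = (1 - γ) * ∑ s, v s * ν₀ s - objective h r μ := by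
  obtain ⟨μ', hμ', hobj⟩ := hv.exists_objective_eq hγ0 hγ1 hν₀
  have : IsGreatest (objective h r '' occupancySet γ ν₀ P) ((1 - γ) * ∑ s, v s * ν₀ s) := by
    refine ⟨⟨μ', hμ', hobj⟩, ?_⟩
    rintro _ ⟨μ, hμ, rfl⟩
    exact hv.objective_le hτ hμ
  rw [subOpt, this.csSup_eq]

theorem IsBellmanSolution.mem_optimalSet_iff {S A : Type*} [Fintype S] [Fintype A] [Nonempty A]
    {h : (A → ℝ) → ℝ} {τ γ : ℝ} (hτ : 0 < τ) (hγ0 : 0 ≤ γ) (hγ1 : γ < 1)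
    {P : TransitionLaw S A} {r : EuclideanSpace ℝ (S × A)} {v : S → ℝ} {π : S → A → ℝ}
    (hv : IsBellmanSolution h τ γ P r v π) {ν₀ : S → ℝ} (hν₀ : ∀ s, 0 ≤ ν₀ s)
    {μ : EuclideanSpace ℝ (S × A)} : μ ∈ optimalSet γ ν₀ h P r ↔
      μ ∈ occupancySet γ ν₀ P ∧ objective h r μ = (1 - γ) * ∑ s, v s * ν₀ s := by
  obtain ⟨μ', hμ', hobj⟩ := hv.exists_objective_eq hγ0 hγ1 hν₀
  refine ⟨fun hμ => ⟨hμ.1, le_antisymm (hv.objective_le hτ hμ.1) (hobj ▸ hμ.2 μ' hμ')⟩,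
    fun hμ => ⟨hμ.1, fun μ' hμ' => hμ.2 ▸ hv.objective_le hτ hμ'⟩⟩

/-- An optimal occupancy measure follows the Bellman policy. -/
theorem IsBellmanSolution.eq_stateMarginal_mul {S A : Type*} [Fintype S] [Fintype A] [Nonempty A]
    {h : (A → ℝ) → ℝ} {τ γ : ℝ} (hτ : 0 < τ) {P : TransitionLaw S A}
    {r : EuclideanSpace ℝ (S × A)} {v : S → ℝ} {π : S → A → ℝ}
    (hv : IsBellmanSolution h τ γ P r v π) {ν₀ : S → ℝ} {μ : EuclideanSpace ℝ (S × A)}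
    (hμ : μ ∈ occupancySet γ ν₀ P) (hobj : objective h r μ = (1 - γ) * ∑ s, v s * ν₀ s)
    (s : S) (a : A) : μ (s, a) = stateMarginal μ s * π s a := by
  rw [hv.objective_eq hμ, sub_eq_self, Finset.sum_eq_zero_iff_of_nonneg fun s _ =>
    mul_nonneg (stateMarginal_nonneg hμ.1 s)
      ((hv s).1.regGap_nonneg hτ (policyOf_mem hμ.1 s))] at hobj
  rw [← stateMarginal_mul_policyOf hμ.1]
  rcases mul_eq_zero.mp (hobj s (Finset.mem_univ s)) with h0 | h0
  · rw [h0, zero_mul, zero_mul]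
  · have h1 := (hv s).1.2 _ (policyOf_mem hμ.1 s)
    rw [h0] at h1
    have h2 : (∑ a, |policyOf μ s a - π s a|) ^ 2 = 0 :=
      le_antisymm (by nlinarith) (sq_nonneg _)
    have h3 := (Finset.sum_eq_zero_iff_of_nonneg fun a _ => abs_nonneg _).mp
      (pow_eq_zero_iff two_ne_zero |>.mp h2) a (Finset.mem_univ a)
    rw [sub_eq_zero.mp (abs_eq_zero.mp h3)]

/-! ### Transferability -/

/-- Quadratic growth of the objective around an optimal occupancy measure. -/
theorem IsBellmanSolution.sum_abs_sub_sq_le {S A : Type*} [Fintype S] [Fintype A] [Nonempty A]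
    {h : (A → ℝ) → ℝ} {τ γ : ℝ} (hτ : 0 < τ) (hγ0 : 0 ≤ γ) (hγ1 : γ < 1) {P : TransitionLaw S A}
    {r : EuclideanSpace ℝ (S × A)} {v : S → ℝ} {π : S → A → ℝ}
    (hv : IsBellmanSolution h τ γ P r v π) {ν₀ : S → ℝ} (hν₀ : ν₀ ∈ stdSimplex ℝ S)
    {μ μ' : EuclideanSpace ℝ (S × A)} (hμ' : μ' ∈ optimalSet γ ν₀ h P r)
    (hμ : μ ∈ occupancySet γ ν₀ P) :
    τ * (∑ s, ∑ a, |μ (s, a) - μ' (s, a)|) ^ 2 ≤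
      4 * effHorizon γ ^ 2 * (objective h r μ' - objective h r μ) := by
  obtain ⟨hμ', hobj⟩ := (hv.mem_optimalSet_iff hτ hγ0 hγ1 hν₀.1).mp hμ'
  have hH : 0 < effHorizon γ := one_div_pos.mpr (by linarith)
  have h1 := sum_abs_sub_le hγ0 hγ1 hμ hμ' (fun s => (hv s).1.1)
    (hv.eq_stateMarginal_mul hτ hμ' hobj)
  set N := ∑ s, ∑ a, |μ (s, a) - μ' (s, a)|
  set x : S → ℝ := fun s => ∑ a, |policyOf μ s a - π s a| with hx
  have hν := stateMarginal_nonneg hμ.1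
  have hN : 0 ≤ N := Finset.sum_nonneg fun s _ => Finset.sum_nonneg fun a _ => abs_nonneg _
  -- Jensen's inequality for the probability weights given by the state marginals.
  have h2 : (∑ s, stateMarginal μ s * x s) ^ 2 ≤ ∑ s, stateMarginal μ s * x s ^ 2 := by
    have hcs := Finset.sum_mul_sq_le_sq_mul_sq Finset.univ (fun s => √(stateMarginal μ s))
      (fun s => √(stateMarginal μ s) * x s)
    simp only [← mul_assoc, mul_pow, Real.sq_sqrt (hν _), Real.mul_self_sqrt (hν _),
      sum_stateMarginal hγ1 hν₀ hμ, one_mul] at hcs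
    exact hcs
  have h3 : τ * ∑ s, stateMarginal μ s * x s ^ 2 ≤
      4 * (objective h r μ' - objective h r μ) := by
    rw [hobj, hv.objective_eq hμ, sub_sub_cancel, Finset.mul_sum, Finset.mul_sum]
    refine Finset.sum_le_sum fun s _ => ?_
    have := mul_le_mul_of_nonneg_left ((hv s).1.2 _ (policyOf_mem hμ.1 s)) (hν s)
    simp only [hx]
    linarith
  calc τ * N ^ 2 ≤ τ * (effHorizon γ * ∑ s, stateMarginal μ s * x s) ^ 2 := by gcongr
    _ = effHorizon γ ^ 2 * (τ * (∑ s, stateMarginal μ s * x s) ^ 2) := by ring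
    _ ≤ effHorizon γ ^ 2 * (4 * (objective h r μ' - objective h r μ)) := by
        refine mul_le_mul_of_nonneg_left (le_trans ?_ h3) (by positivity)
        gcongr
    _ = _ := by ring

/-- Hölder for ℓ^∞ and ℓ¹, with the maximum norm bounded by the Euclidean one. -/
theorem abs_inner_le_norm_mul_sum_abs {S A : Type*} [Fintype S] [Fintype A]
    (x y : EuclideanSpace ℝ (S × A)) :
    |inner ℝ x y| ≤ ‖x‖ * ∑ s, ∑ a, |y (s, a)| := by
  rw [inner_prod_eq_sum, Finset.mul_sum]
  refine (Finset.abs_sum_le_sum_abs _ _).trans (Finset.sum_le_sum fun s _ => ?_)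
  rw [Finset.mul_sum]
  refine (Finset.abs_sum_le_sum_abs _ _).trans (Finset.sum_le_sum fun a _ => ?_)
  rw [abs_mul]
  exact mul_le_mul_of_nonneg_right (PiLp.norm_apply_le x (s, a)) (abs_nonneg _)

/-- A reward that is close to `rE` up to constants transfers to every transition law. -/
theorem subOpt_le_of_norm_sub_smul {S A : Type*} [Fintype S] [Fintype A] [Nonempty A]
    {h : (A → ℝ) → ℝ} {τ γ : ℝ} (hτ : 0 < τ) (hγ0 : 0 ≤ γ) (hγ1 : γ < 1) {P : TransitionLaw S A}
    {rE r : EuclideanSpace ℝ (S × A)} {vE v : S → ℝ} {πE π : S → A → ℝ}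
    (hvE : IsBellmanSolution h τ γ P rE vE πE) (hv : IsBellmanSolution h τ γ P r v π)
    {ν₀ : S → ℝ} (hν₀ : ν₀ ∈ stdSimplex ℝ S) {μ : EuclideanSpace ℝ (S × A)}
    (hμ : μ ∈ optimalSet γ ν₀ h P r) (c : ℝ) :
    subOpt γ ν₀ h P rE μ ≤ ‖r - rE - c • oneVec S A‖ ^ 2 * effHorizon γ ^ 2 / τ := by
  obtain ⟨μE, hμE, hobjE⟩ := hvE.exists_objective_eq hγ0 hγ1 hν₀.1
  rw [hvE.subOpt_eq hτ hγ0 hγ1 hν₀.1, ← hobjE]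
  have hgrow := hv.sum_abs_sub_sq_le hτ hγ0 hγ1 hν₀ hμ hμE
  have h1 : inner ℝ (oneVec S A) (μE - μ) = 0 := by
    rw [inner_sub_right, inner_oneVec hγ1 hν₀ hμE, inner_oneVec hγ1 hν₀ hμ.1, sub_self]
  have h2 := objective_sub_objective h r rE μE
  have h3 := objective_sub_objective h r rE μ
  have h4 : inner ℝ (r - rE - c • oneVec S A) (μE - μ) =
      inner ℝ (r - rE) μE - inner ℝ (r - rE) μ := by
    rw [inner_sub_left, real_inner_smul_left, h1, inner_sub_right]
    ring
  have h5 := neg_le_of_abs_le (abs_inner_le_norm_mul_sum_abs (r - rE - c • oneVec S A) (μE - μ))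
  have hH : 0 < effHorizon γ := one_div_pos.mpr (by linarith)
  simp only [PiLp.sub_apply] at h5
  set N := ∑ s, ∑ a, |μE (s, a) - μ (s, a)|
  set x := ‖r - rE - c • oneVec S A‖
  set H := effHorizon γ
  set G := objective h r μ - objective h r μE with hG
  have h6 : objective h rE μE - objective h rE μ ≤ x * N - G := by linarith
  refine h6.trans ((le_div_iff₀ hτ).mpr ?_)
  -- Growth gives G ≥ τN²/(4H²). Completing the square bounds xN - τN²/(4H²) by x²H²/τ, whatever N
  -- is.
  have h7 : (x * N - G) * τ * (4 * H ^ 2) ≤ x ^ 2 * H ^ 2 * (4 * H ^ 2) := by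
    nlinarith [sq_nonneg (2 * x * H ^ 2 - τ * N)]
  exact le_of_mul_le_mul_right h7 (by positivity)

/-- The loss of a perturbation `ν' π' = ν π + d` of a distribution `ν π`. -/
theorem mul_regGap_le {A : Type*} [Fintype A] {h : (A → ℝ) → ℝ} {τ κ νmin : ℝ} (hτ : 0 < τ)
    (hνmin : 0 < νmin) {q p p' d : A → ℝ} (hp : p ∈ stdSimplex ℝ A)
    (hs : IsSmoothAt h τ κ q p) (hp' : p' ∈ stdSimplex ℝ A) {n n' : ℝ} (hn' : νmin ≤ n')
    (hd : ∀ a, n' * p' a = n * p a + d a) (hn : n' = n + ∑ a, d a) :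
    n' * regGap h q p p' ≤ τ * κ / νmin * ∑ a, d a ^ 2 := by
  obtain ⟨hκ, c, hc0, hc, hgap⟩ := hs
  have hn0 : 0 < n' := hνmin.trans_le hn'
  -- With e = ∑d one has n'(p' - p) = d - ep, and the weighted square sum is ∑d²/p - e²; the change
  -- of marginal only helps.
  have h1 : n' ^ 2 * ∑ a, (p' a - p a) ^ 2 / p a ≤ ∑ a, d a ^ 2 / p a := by
    set e := ∑ a, d a with he
    have e1 : ∀ a, n' ^ 2 * ((p' a - p a) ^ 2 / p a) =
        d a ^ 2 / p a - 2 * e * d a + e ^ 2 * p a := by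
      intro a
      have e2 : n' * (p' a - p a) = d a - e * p a := by rw [mul_sub, hd, hn]; ring
      have := (hκ a).1.ne'
      rw [mul_div_assoc', ← mul_pow, e2]
      field_simp
      ring
    rw [Finset.mul_sum, Finset.sum_congr rfl fun a _ => e1 a, Finset.sum_add_distrib,
      Finset.sum_sub_distrib, ← Finset.mul_sum, ← Finset.mul_sum, hp.2, ← he]
    nlinarith [sq_nonneg e]
  have h2 : c * ∑ a, d a ^ 2 / p a ≤ κ * ∑ a, d a ^ 2 := by
    rw [Finset.mul_sum, Finset.mul_sum]
    refine Finset.sum_le_sum fun a _ => ?_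
    rw [mul_div_assoc', div_le_iff₀ (hκ a).1]
    nlinarith [mul_le_mul_of_nonneg_right (hc a) (sq_nonneg (d a))]
  have h3 : 0 ≤ κ * ∑ a, d a ^ 2 :=
    le_trans (mul_nonneg hc0 (Finset.sum_nonneg fun a _ =>
      div_nonneg (sq_nonneg _) (hκ a).1.le)) h2
  have h4 : n' * (n' * regGap h q p p') ≤ τ * (κ * ∑ a, d a ^ 2) := by
    calc n' * (n' * regGap h q p p') = n' ^ 2 * regGap h q p p' := by ring
      _ ≤ n' ^ 2 * (τ * c * ∑ a, (p' a - p a) ^ 2 / p a) := by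
          gcongr
          exact hgap p' hp'
      _ = τ * (c * (n' ^ 2 * ∑ a, (p' a - p a) ^ 2 / p a)) := by ring
      _ ≤ τ * (c * ∑ a, d a ^ 2 / p a) := by gcongr
      _ ≤ _ := by gcongr
  calc n' * regGap h q p p' ≤ τ * (κ * ∑ a, d a ^ 2) / n' := by
        rw [le_div_iff₀ hn0]
        linarith
    _ ≤ τ * (κ * ∑ a, d a ^ 2) / νmin := by gcongr
    _ = _ := by ring

/-- Suboptimality of an expert for `rE` under another reward `r` bounds the distance of `r - rE` to
the shaping transformations. -/
theorem norm_sub_starProjection_sq_le {S A : Type*} [Fintype S] [Fintype A] [Nonempty S]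
    [Nonempty A] {h : (A → ℝ) → ℝ} {τ κ γ : ℝ} (hτ : 0 < τ) (hγ0 : 0 ≤ γ) (hγ1 : γ < 1)
    {P : TransitionLaw S A} {rE r : EuclideanSpace ℝ (S × A)} {vE v : S → ℝ} {πE π : S → A → ℝ}
    (hvE : IsBellmanSolution h τ γ P rE vE πE) (hv : IsBellmanSolution h τ γ P r v π)
    (hs : ∀ s, IsSmoothAt h τ κ (actionValue γ P rE vE s) (πE s))
    {ν₀ : S → ℝ} (hν₀ : ∀ s, 0 ≤ ν₀ s) {νmin : ℝ} (hνmin : 0 < νmin)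
    (hexpl : ∀ μ ∈ occupancySet γ ν₀ P, ∀ s, νmin ≤ stateMarginal μ s) {D : ℝ} (hτD : τ < D)
    (hD : ‖r - rE‖ ≤ D) {μE : EuclideanSpace ℝ (S × A)} (hμE : μE ∈ optimalSet γ ν₀ h P rE)
    {ε : ℝ} (hε : subOpt γ ν₀ h P r μE ≤ ε) :
    ‖(r - rE) - (shapingSpace γ P).starProjection (r - rE)‖ ^ 2 ≤ 4 * D * κ / νmin * ε := by
  set U := shapingSpace γ P
  set d := (r - rE) - U.starProjection (r - rE) with hd
  have hdU : d ∈ Uᗮ := U.sub_starProjection_mem_orthogonal _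
  have hdin : inner ℝ (r - rE) d = ‖d‖ ^ 2 := by
    have h1 : r - rE = d + U.starProjection (r - rE) := by rw [hd]; abel
    rw [h1, inner_add_left, real_inner_self_eq_norm_sq,
      (Submodule.mem_orthogonal _ _).mp hdU _ (U.starProjection_apply_mem _), add_zero]
  have hdD : ‖d‖ ≤ D := by
    refine (abs_le_of_sq_le_sq' ?_ (norm_nonneg (r - rE))).2.trans hD
    have := real_inner_le_norm (r - rE) d
    rw [hdin] at this
    nlinarith [norm_nonneg d, norm_nonneg (r - rE), sq_nonneg (‖d‖ - ‖r - rE‖)]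
  have hD0 : 0 < D := hτ.trans hτD
  obtain ⟨hμo, hobj⟩ := (hvE.mem_optimalSet_iff hτ hγ0 hγ1 hν₀).mp hμE
  have hμπ := hvE.eq_stateMarginal_mul hτ hμo hobj
  have hκ0 : 0 < κ := by
    obtain ⟨s⟩ := ‹Nonempty S›
    obtain ⟨a⟩ := ‹Nonempty A›
    obtain ⟨h1, h2⟩ := (hs s).1 a
    by_contra! hcon
    nlinarith
  -- This step size serves twice: tD is half the lower bound νmin/κ on the expert, so the
  -- perturbation stays nonnegative, and the quadratic loss is τ/D < 1 times half the linear gain.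
  set t := νmin / (2 * D * κ) with ht
  have ht0 : 0 < t := by positivity
  have hmem : μE + t • d ∈ occupancySet γ ν₀ P := by
    refine add_mem_occupancySet hμo (Submodule.smul_mem _ _ hdU) ?_
    rintro ⟨s, a⟩
    have h1 : |d (s, a)| ≤ D := (PiLp.norm_apply_le d (s, a)).trans hdD
    have h2 := (hs s).1 a
    have h3 := hexpl _ hμo s
    have h4 : νmin / κ ≤ μE (s, a) := by
      rw [hμπ, div_le_iff₀ hκ0]
      nlinarith [hνmin.trans_le h3]
    have h5 : t * D ≤ νmin / κ := by
      rw [ht]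
      have : νmin / (2 * D * κ) * D = νmin / κ / 2 := by field_simp
      rw [this]
      have : 0 < νmin / κ := by positivity
      linarith
    have h6 := mul_le_mul_of_nonneg_left (neg_le_of_abs_le h1) ht0.le
    simp only [PiLp.add_apply, PiLp.smul_apply, smul_eq_mul]
    linarith
  have hloss : objective h rE μE - objective h rE (μE + t • d) ≤
      τ * κ / νmin * (t ^ 2 * ‖d‖ ^ 2) := by
    rw [hobj, hvE.objective_eq hmem, sub_sub_cancel, EuclideanSpace.real_norm_sq_eq,
      Fintype.sum_prod_type, Finset.mul_sum, Finset.mul_sum]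
    refine Finset.sum_le_sum fun s _ => ?_
    refine (mul_regGap_le hτ hνmin (n := stateMarginal μE s) (d := fun a => t * d (s, a))
      (hvE s).1.1 (hs s) (policyOf_mem hmem.1 s) (hexpl _ hmem s) (fun a => ?_) ?_).trans_eq ?_
    · rw [stateMarginal_mul_policyOf hmem.1, ← hμπ]
      rfl
    · rw [stateMarginal, stateMarginal, ← Finset.sum_add_distrib]
      rfl
    · simp_rw [mul_pow, ← Finset.mul_sum]
  have hobj' := hv.objective_le hτ hmem
  rw [hv.subOpt_eq hτ hγ0 hγ1 hν₀] at hε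
  have h2 := objective_sub_objective h r rE μE
  have h3 := objective_sub_objective h r rE (μE + t • d)
  rw [inner_add_right, inner_smul_right, hdin] at h3
  -- The left side bounds from below what the perturbation gains over the expert in J(r̂, ·), which
  -- is at most ε.
  have h4 : t * ‖d‖ ^ 2 - τ * κ / νmin * (t ^ 2 * ‖d‖ ^ 2) ≤ ε := by linarith
  have h5 : τ * κ / νmin * (t ^ 2 * ‖d‖ ^ 2) ≤ t * ‖d‖ ^ 2 / 2 := by
    have : τ * κ / νmin * (t ^ 2 * ‖d‖ ^ 2) = τ / D * (t * ‖d‖ ^ 2 / 2) := by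
      rw [ht]
      field_simp
    rw [this]
    exact mul_le_of_le_one_left (by positivity) ((div_le_one hD0).mpr hτD.le)
  have h6 : t * ‖d‖ ^ 2 / 2 ≤ ε := by linarith
  calc ‖d‖ ^ 2 = 4 * D * κ / νmin * (t * ‖d‖ ^ 2 / 2) := by
        rw [ht]
        field_simp
        ring
    _ ≤ _ := by gcongr

/-- Transferability for a regularizer whose maximizers exist, grow quadratically, and are smooth
with parameter `κ` for action values of span at most `2 R H_γ`. -/
theorem isTransferable_of_softmax {S A : Type*} [Fintype S] [Fintype A] [Nonempty S]
    [Nonempty A] {γ : ℝ} (hγ0 : 0 < γ) (hγ1 : γ < 1) {ν₀ : S → ℝ} (hν₀ : ν₀ ∈ stdSimplex ℝ S)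
    {𝓡 : Set (EuclideanSpace ℝ (S × A))} (h𝓡 : IsCompact 𝓡)
    {rE rhat : EuclideanSpace ℝ (S × A)} (hrE : rE ∈ 𝓡) (hrhat : rhat ∈ 𝓡)
    {τ : ℝ} (hτ0 : 0 < τ) (hτD : τ < rewardDiam 𝓡) {P : Fin 2 → TransitionLaw S A}
    (hθ : 0 < lawAngle γ 2 (P 0) (P 1)) {νmin : ℝ} (hνmin : 0 < νmin)
    (hexpl : ∀ k, ∀ μ ∈ occupancySet γ ν₀ (P k), ∀ s, νmin ≤ stateMarginal μ s)
    {εhat : ℝ} {μE : Fin 2 → EuclideanSpace ℝ (S × A)} {h : (A → ℝ) → ℝ} {κ : ℝ}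
    (hh : ∀ q, ∃ p, IsSoftmax h τ q p ∧
      ((∀ a b, q a - q b ≤ 2 * rewardBound 𝓡 * effHorizon γ) → IsSmoothAt h τ κ q p))
    (hμE : ∀ k, μE k ∈ optimalSet γ ν₀ h (P k) rE)
    (hsub : ∀ k, subOpt γ ν₀ h (P k) rhat (μE k) ≤ εhat) {C : ℝ}
    (hC : 4 * rewardDiam 𝓡 * κ * effHorizon γ ^ 2 * νmin ≤ C) :
    IsTransferable γ ν₀ h rE rhat Set.univ
      (C / (νmin ^ 2 * τ * Real.sin (lawAngle γ 2 (P 0) (P 1) / 2) ^ 2) * εhat) := by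
  choose f hf hsm using hh
  set θ := lawAngle γ 2 (P 0) (P 1) with hθdef
  have hR : ∀ x, |rE x| ≤ rewardBound 𝓡 := by
    intro x
    have hbdd : BddAbove ((fun r : EuclideanSpace ℝ (S × A) =>
        ‖(WithLp.ofLp r : S × A → ℝ)‖) '' 𝓡) :=
      (h𝓡.image (by fun_prop)).bddAbove
    exact (norm_le_pi_norm (WithLp.ofLp rE) x).trans (le_csSup hbdd ⟨rE, hrE, rfl⟩)
  have hD : ‖rhat - rE‖ ≤ rewardDiam 𝓡 := by
    rw [← dist_eq_norm]
    exact Metric.dist_le_diam_of_mem h𝓡.isBounded hrhat hrE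
  have hsol := fun (Q : TransitionLaw S A) r =>
    exists_isBellmanSolution hτ0 hγ0.le hγ1 f hf Q r
  have hdist : ∀ k, ‖(rhat - rE) - (shapingSpace γ (P k)).starProjection (rhat - rE)‖ ^ 2 ≤
      4 * rewardDiam 𝓡 * κ / νmin * εhat := by
    intro k
    obtain ⟨vE, hvE⟩ := hsol (P k) rE
    obtain ⟨v, hv⟩ := hsol (P k) rhat
    exact norm_sub_starProjection_sq_le hτ0 hγ0.le hγ1 hvE hv
      (fun s => hsm _ (hvE.actionValue_sub_le hτ0 hγ0.le hγ1 hR s)) hν₀.1 hνmin (hexpl k) hτD hD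
      (hμE k) (hsub k)
  have hone : oneVec S A ≠ 0 := by
    obtain ⟨s⟩ := ‹Nonempty S›
    obtain ⟨a⟩ := ‹Nonempty A›
    intro h0
    have : oneVec S A (s, a) = 0 := by rw [h0]; rfl
    exact one_ne_zero this
  obtain ⟨c, hc⟩ := exists_norm_sub_smul_sq_mul_sin_sq_le
    (oneVec_mem_shapingSpace hγ1 (P 0)) (oneVec_mem_shapingSpace hγ1 (P 1)) hone hθ
    (hdist 0) (hdist 1)
  have hsin : 0 < Real.sin (θ / 2) ^ 2 := by
    have h1 := (principalAngle_two_mem_Icc (shapingSpace γ (P 0)) (shapingSpace γ (P 1))).2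
    exact pow_pos (Real.sin_pos_of_pos_of_lt_pi (by linarith)
      (by change θ ≤ _ at h1; linarith [Real.pi_pos])) 2
  -- Nonnegativity is needed to enlarge the constant in front of ε̂ to C at the end.
  have hε0 : 0 ≤ εhat := by
    obtain ⟨v, hv⟩ := hsol (P 0) rhat
    refine le_trans ?_ (hsub 0)
    rw [hv.subOpt_eq hτ0 hγ0.le hγ1 hν₀.1]
    exact sub_nonneg.mpr (hv.objective_le hτ0 (hμE 0).1)
  intro Q _
  obtain ⟨vE, hvE⟩ := hsol Q rE
  obtain ⟨v, hv⟩ := hsol Q rhat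
  refine ⟨?_, fun μ hμ => ?_⟩
  · obtain ⟨μ, hμ⟩ := hv.exists_objective_eq hγ0.le hγ1 hν₀.1
    exact ⟨μ, (hv.mem_optimalSet_iff hτ0 hγ0.le hγ1 hν₀.1).mpr hμ⟩
  · refine (subOpt_le_of_norm_sub_smul hτ0 hγ0.le hγ1 hvE hv hν₀ hμ c).trans ?_
    change _ * Real.sin (θ / 2) ^ 2 ≤ _ at hc
    rw [← le_div_iff₀ hsin] at hc
    calc ‖rhat - rE - c • oneVec S A‖ ^ 2 * effHorizon γ ^ 2 / τ
        ≤ 4 * rewardDiam 𝓡 * κ / νmin * εhat / Real.sin (θ / 2) ^ 2 * effHorizon γ ^ 2 / τ := by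
          gcongr
      _ = 4 * rewardDiam 𝓡 * κ * effHorizon γ ^ 2 * νmin /
          (νmin ^ 2 * τ * Real.sin (θ / 2) ^ 2) * εhat := by
          field_simp
      _ ≤ _ := by gcongr

theorem one_le_effHorizon {γ : ℝ} (hγ0 : 0 ≤ γ) (hγ1 : γ < 1) : 1 ≤ effHorizon γ := by
  rw [effHorizon, le_div_iff₀ (by linarith)]
  linarith

theorem rewardBound_nonneg {S A : Type*} [Fintype S] [Fintype A]
    (𝓡 : Set (EuclideanSpace ℝ (S × A))) : 0 ≤ rewardBound 𝓡 := by
  refine Real.sSup_nonneg ?_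
  rintro _ ⟨r, -, rfl⟩
  exact norm_nonneg _

end

/-- The argument gives the constant 4DκH_γ²/(νmin τ sin²(θ₂/2)), with κ = |A| exp(2RH_γ/τ) for
Shannon and κ = (√|A| + 2RH_γ/τ)³ for Tsallis. It remains to compare this with the larger constants
claimed. -/
theorem corollary1 {S A : Type*} [Fintype S] [Fintype A] [Nontrivial S] [Nontrivial A]
    (γ : ℝ) (hγ0 : 0 < γ) (hγ1 : γ < 1)
    (ν₀ : S → ℝ) (hν₀ : ν₀ ∈ stdSimplex ℝ S)
    (𝓡 : Set (EuclideanSpace ℝ (S × A))) (h𝓡 : IsCompact 𝓡)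
    (rE rhat : EuclideanSpace ℝ (S × A)) (hrE : rE ∈ 𝓡) (hrhat : rhat ∈ 𝓡)
    (τ : ℝ) (hτ0 : 0 < τ) (hτD : τ < rewardDiam 𝓡)
    (P : Fin 2 → TransitionLaw S A) (hθ : 0 < lawAngle γ 2 (P 0) (P 1))
    (νmin : ℝ) (hνmin : 0 < νmin)
    (hexpl : ∀ k, ∀ μ ∈ occupancySet γ ν₀ (P k), ∀ s, νmin ≤ stateMarginal μ s)
    (εhat : ℝ) (μE : Fin 2 → EuclideanSpace ℝ (S × A)) :
    ((∀ k, μE k ∈ optimalSet γ ν₀ (shannonReg τ) (P k) rE) →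
      (∀ k, subOpt γ ν₀ (shannonReg τ) (P k) rhat (μE k) ≤ εhat) →
      IsTransferable γ ν₀ (shannonReg τ) rE rhat Set.univ
        (2 * effHorizon γ ^ 2 * rewardDiam 𝓡 * (Fintype.card S : ℝ)
              * (Fintype.card A : ℝ) ^ (2 + effHorizon γ)
              * Real.exp (2 * rewardBound 𝓡 * effHorizon γ / τ)
            / (νmin ^ 2 * τ * Real.sin (lawAngle γ 2 (P 0) (P 1) / 2) ^ 2) * εhat)) ∧
    ((∀ k, μE k ∈ optimalSet γ ν₀ (tsallisReg τ) (P k) rE) →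
      (∀ k, subOpt γ ν₀ (tsallisReg τ) (P k) rhat (μE k) ≤ εhat) →
      IsTransferable γ ν₀ (tsallisReg τ) rE rhat Set.univ
        (4 * √2 * effHorizon γ ^ 5 * rewardDiam 𝓡 * (Fintype.card S : ℝ)
              * (Fintype.card A : ℝ) ^ 2
              * (2 * rewardBound 𝓡 / τ + 3 * √(Fintype.card A : ℝ)) ^ 3
            / (νmin ^ 2 * τ * Real.sin (lawAngle γ 2 (P 0) (P 1) / 2) ^ 2) * εhat)) := by
  have hH := one_le_effHorizon hγ0.le hγ1
  have hR := rewardBound_nonneg 𝓡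
  have hD : 0 < rewardDiam 𝓡 := hτ0.trans hτD
  have hn : (2 : ℝ) ≤ Fintype.card S := by exact_mod_cast Fintype.one_lt_card
  have hm : (1 : ℝ) ≤ Fintype.card A := by exact_mod_cast Fintype.card_pos
  have hm2 : (1 : ℝ) ≤ (Fintype.card A : ℝ) ^ 2 := one_le_pow₀ hm
  -- The marginals have total mass one, so νmin ≤ 1. This absorbs the extra power of νmin in the
  -- stated denominator; for Shannon, 4νmin ≤ 2|S| then uses |S| ≥ 2.
  have hν1 : ∀ μ ∈ occupancySet γ ν₀ (P 0), νmin ≤ 1 := by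
    intro μ hμ
    obtain ⟨s⟩ := (inferInstance : Nonempty S)
    rw [← sum_stateMarginal hγ1 hν₀ hμ]
    exact (hexpl 0 μ hμ s).trans (Finset.single_le_sum
      (fun s _ => stateMarginal_nonneg hμ.1 s) (Finset.mem_univ s))
  refine ⟨fun hμE hsub => ?_, fun hμE hsub => ?_⟩
  · refine isTransferable_of_softmax hγ0 hγ1 hν₀ h𝓡 hrE hrhat hτ0 hτD hθ hνmin hexpl
      (fun q => ⟨_, isSoftmax_boltzmann hτ0 q, fun hq => isSmoothAt_boltzmann hτ0 hq⟩) hμE hsub ?_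
    have hν := hν1 _ (hμE 0).1
    have hpow : (Fintype.card A : ℝ) ≤ (Fintype.card A : ℝ) ^ (2 + effHorizon γ) := by
      conv_lhs => rw [← Real.rpow_one (Fintype.card A : ℝ)]
      exact Real.rpow_le_rpow_of_exponent_le hm (by linarith)
    calc _ = 2 * effHorizon γ ^ 2 * rewardDiam 𝓡 * (2 * νmin) * (Fintype.card A : ℝ) *
          Real.exp (2 * rewardBound 𝓡 * effHorizon γ / τ) := by ring
      _ ≤ _ := by
          gcongr
          linarith
  · refine isTransferable_of_softmax hγ0 hγ1 hν₀ h𝓡 hrE hrhat hτ0 hτD hθ hνmin hexpl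
      (fun q => ?_) hμE hsub
      (κ := (√(Fintype.card A : ℝ) + 2 * rewardBound 𝓡 * effHorizon γ / τ) ^ 3) ?_
    · obtain ⟨p, hp, hs⟩ := exists_tsallis_isSoftmax_isSmoothAt hτ0 q
      exact ⟨p, hp, hs _⟩
    have hν := hν1 _ (hμE 0).1
    have hsq : 1 ≤ √2 := Real.one_le_sqrt.mpr (by norm_num)
    have hm0 := Real.sqrt_nonneg (Fintype.card A : ℝ)
    -- Extracting H_γ ≥ 1 here turns κ into H_γ³ times the stated cube, which with H_γ² accounts for
    -- the fifth power.
    have hκ : √(Fintype.card A : ℝ) + 2 * rewardBound 𝓡 * effHorizon γ / τ ≤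
        effHorizon γ * (2 * rewardBound 𝓡 / τ + 3 * √(Fintype.card A : ℝ)) := by
      rw [mul_add, mul_div_right_comm, mul_comm (effHorizon γ) (2 * rewardBound 𝓡 / τ)]
      nlinarith
    calc _ ≤ 4 * rewardDiam 𝓡 *
          (effHorizon γ * (2 * rewardBound 𝓡 / τ + 3 * √(Fintype.card A : ℝ))) ^ 3 *
            effHorizon γ ^ 2 * 1 := by gcongr
      _ = 4 * 1 * effHorizon γ ^ 5 * rewardDiam 𝓡 * 1 * 1 *
          (2 * rewardBound 𝓡 / τ + 3 * √(Fintype.card A : ℝ)) ^ 3 := by ring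
      _ ≤ _ := by
          gcongr
          linarith
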